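/- Let $\ell$ be a prime number, $K$ a number field and $F$ a subfield of $K$ such that $K/F$ is Galois, with group $G=\mathrm{Gal}(K/F)$. Assume that $F$ is totally $\ell$-adic (every field embedding of $F$ in an algebraic closure of $\mathbb{Q}_\ell$ has its image in $\mathbb{Q}_\ell$) and that $K/F$ is non-split above $\ell$ (over each place of $F$ above $\ell$ there is exactly one place of $K$). Let $u\mapsto\langle u\rangle$ be the projection of $\mathbb{Z}_\ell^\times$ onto $1+2\ell\mathbb{Z}_\ell$ whose kernel is the group of roots of unity of $\mathbb{Z}_\ell$. Fix a field embedding $\varphi:\mathbb{C}\to\mathbb{C}_\ell$. The $\ell$-adic absolute values of $K$, with values in the torsion-free group $(1+2\ell\mathbb{Z}_\ell)\,\ell^{\mathbb{Q}}$, are the following maps on $K^\times$, where $N\mathfrak{p}$ is the cardinality of the residue field at a finite place $\mathfrak{p}$ and $v_{\mathfrak p}$ is the normalized valuation: $$|x|_{\tau}^{(\ell)}=\ell^{-v_\ell(\varphi(\tau(x)))}\quad\text{for each embedding }\tau:K\to\mathbb{C},$$ $$|x|_{\mathfrak p}^{(\ell)}=\langle N\mathfrak{p}^{-v_{\mathfrak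 p}(x)}\rangle\quad\text{for }\mathfrak p\nmid\ell\infty,$$ $$|x|_{\mathfrak p}^{(\ell)}=\langle N_{K_{\mathfrak p}/\mathbb{Q}_\ell}(x)\,N\mathfrak{p}^{-v_{\mathfrak p}(x)}\rangle\,N\mathfrak{p}^{v_{\mathfrak p}(x)}\quad\text{for }\mathfrak p\mid\ell.$$ Let $\mu_K^{(\ell)}\subset K^\times$ be the subgroup on which all these absolute values are trivial; it is stable under $G$. For each infinite place $\mathfrak{p}_\infty$ of $F$ let $\chi_{\mathfrak{p}_\infty}=\mathrm{Ind}_{D_{\mathfrak{p}_\infty}}^{G}1$ be the character of $G$ induced from the trivial character of the decomposition group $D_{\mathfrak{p}_\infty}$ of any chosen place of $K$ above $\mathfrak{p}_\infty$. Then the $\mathbb{Q}$-vector space $\mathbb{Q}\otimes_{\mathbb{Z}}\mu_K^{(\ell)}$ is finite-dimensional, and the character of the $\mathbb{Q}[G]$-module $\mathbb{Q}\otimes_{\mathbb{Z}}\mu_K^{(\ell)}$ is $$\sum_{\mathfrak{p}_\infty}\left(\chi_{\mathfrak{p}_\infty}-1\right),$$ where the sum runs over the infinite places of $F$. -/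

import Mathlib

open scoped NumberField

namespace LadicWeil

section PrincipalUnits

variable (ℓ : ℕ) [Fact ℓ.Prime]

/-- The group `1 + 2ℓℤ_ℓ` of principal units of `ℤ_ℓ`. -/
def principalUnits : Subgroup ℤ_[ℓ]ˣ where
  carrier := {u | (2 * ℓ : ℤ_[ℓ]) ∣ (u : ℤ_[ℓ]) - 1}
  one_mem' := by simp
  mul_mem' {a b} ha hb := by
    have h : ((a * b : ℤ_[ℓ]ˣ) : ℤ_[ℓ]) - 1 = a * ((b : ℤ_[ℓ]) - 1) + ((a : ℤ_[ℓ]) - 1) := by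
      push_cast; ring
    simp only [Set.mem_ofPred_eq] at *
    rw [h]
    exact dvd_add (hb.mul_left _) ha
  inv_mem' {a} ha := by
    have h : ((a⁻¹ : ℤ_[ℓ]ˣ) : ℤ_[ℓ]) - 1 = -(a⁻¹ : ℤ_[ℓ]ˣ) * ((a : ℤ_[ℓ]) - 1) := by
      rw [mul_sub, neg_mul, Units.inv_mul]; ring
    simp only [Set.mem_ofPred_eq] at *
    rw [h]
    exact ha.mul_left _

variable {ℓ}

theorem mem_principalUnits {u : ℤ_[ℓ]ˣ} :
    u ∈ principalUnits ℓ ↔ (2 * ℓ : ℤ_[ℓ]) ∣ (u : ℤ_[ℓ]) - 1 := Iff.rfl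

theorem eq_one_of_pow_prime {u : ℤ_[ℓ]ˣ} (hu : u ∈ principalUnits ℓ) {q : ℕ} (hq : q.Prime)
    (h : u ^ q = 1) : u = 1 := by
  have hp : Prime (ℓ : ℤ_[ℓ]) := PadicInt.prime_p
  have hlu : (ℓ : ℤ_[ℓ]) ∣ (u : ℤ_[ℓ]) - 1 := (Dvd.intro_left _ rfl).trans hu
  have hn1 : ¬ (ℓ : ℤ_[ℓ]) ∣ 1 := fun h => hp.not_isUnit (isUnit_of_dvd_one h)
  have hnu : ¬ (ℓ : ℤ_[ℓ]) ∣ (u : ℤ_[ℓ]) := fun h => hp.not_isUnit (isUnit_of_dvd_unit h u.isUnit)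
  have hg := (Commute.all (u : ℤ_[ℓ]) 1).geom_sum₂_mul q
  have hpow : (u : ℤ_[ℓ]) ^ q = 1 := by rw [← Units.val_pow_eq_pow_val, h, Units.val_one]
  rw [hpow, one_pow, sub_self, mul_eq_zero] at hg
  rcases hg with hg | hg
  · exfalso
    by_cases hql : q = ℓ
    · subst hql
      by_cases h2 : q = 2
      · subst h2
        simp [Finset.sum_range_succ] at hg
        have h4 : (2 * 2 : ℤ_[2]) ∣ (u : ℤ_[2]) - 1 := by simpa [mem_principalUnits] using hu
        have hu' : (u : ℤ_[2]) - 1 = -2 := by linear_combination hg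
        rw [hu', dvd_neg] at h4
        have : (2 : ℤ_[2]) ∣ 1 := by
          have h20 : (2 : ℤ_[2]) ≠ 0 := two_ne_zero
          exact (mul_dvd_mul_iff_left h20).1 (by simpa using h4)
        exact hn1 (by simpa using this)
      · have hodd : Odd q := hq.odd_of_ne_two h2
        obtain ⟨b, hb⟩ := hlu
        have := odd_sq_dvd_geom_sum₂_sub (1 : ℤ_[q]) b hodd
        have hu' : (u : ℤ_[q]) = 1 + q * b := by linear_combination hb
        rw [← hu', hg] at this
        simp only [one_pow, mul_one, zero_sub, dvd_neg] at this
        rw [pow_two] at this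
        exact hn1 ((mul_dvd_mul_iff_left hp.ne_zero).1 (by simpa using this))
    · refine not_dvd_geom_sum₂ (n := q) hp hlu hnu ?_ (by rw [hg]; exact dvd_zero _)
      rw [← PadicInt.norm_lt_one_iff_dvd, PadicInt.norm_natCast_lt_one_iff]
      exact fun hd => hql ((Nat.prime_dvd_prime_iff_eq Fact.out hq).1 hd).symm
  · exact Units.ext (by simpa [sub_eq_zero] using hg)

theorem eq_one_of_isOfFinOrder {u : ℤ_[ℓ]ˣ} (hu : u ∈ principalUnits ℓ) (h : IsOfFinOrder u) :
    u = 1 := by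
  obtain ⟨n, hn, hun⟩ := isOfFinOrder_iff_pow_eq_one.1 h
  induction n using Nat.recOnMul generalizing u with
  | zero => exact absurd hn (lt_irrefl _)
  | one => simpa using hun
  | prime q hq => exact eq_one_of_pow_prime hu hq hun
  | mul a b iha ihb =>
    have ha : 0 < a := Nat.pos_of_mul_pos_right hn
    have hb : 0 < b := Nat.pos_of_mul_pos_left hn
    have := ihb (pow_mem hu a) h.pow hb (by rw [← pow_mul, hun])
    exact iha hu h ha this

theorem exists_principalPart (u : ℤ_[ℓ]ˣ) :
    ∃ v ∈ principalUnits ℓ, IsOfFinOrder (u / v) := by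
  by_cases h2 : ℓ = 2
  · subst h2
    have key : ∀ x : ZMod (2 ^ 2), IsUnit x → x = 1 ∨ x = -1 := by decide
    have hdvd : ∀ y : ℤ_[2], PadicInt.toZModPow 2 y = 0 → (2 * (2 : ℕ) : ℤ_[2]) ∣ y := by
      intro y hy
      rw [← RingHom.mem_ker, PadicInt.ker_toZModPow, Ideal.mem_span_singleton] at hy
      have h4 : (2 * (2 : ℕ) : ℤ_[2]) = ((2 : ℕ) : ℤ_[2]) ^ 2 := by push_cast; ring
      rwa [h4]
    rcases key _ (u.isUnit.map (PadicInt.toZModPow 2)) with h | h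
    · refine ⟨u, hdvd _ ?_, by simp⟩
      rw [map_sub, h, map_one, sub_self]
    · refine ⟨-u, hdvd _ ?_, ?_⟩
      · rw [Units.val_neg, map_sub, map_neg, h, map_one, neg_neg, sub_self]
      · refine isOfFinOrder_iff_pow_eq_one.2 ⟨2, two_pos, ?_⟩
        rw [div_pow, neg_sq, div_self']
  · have h2' : 2 ≤ ℓ := (Fact.out : ℓ.Prime).two_le
    have hn0 : ℓ - 1 ≠ 0 := by omega
    have hu1 : ‖(u : ℤ_[ℓ])‖ = 1 := PadicInt.norm_units u
    let f : Polynomial ℤ_[ℓ] := Polynomial.X ^ (ℓ - 1) - 1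
    have hf : ∀ x : ℤ_[ℓ], f.aeval x = x ^ (ℓ - 1) - 1 := fun x => by simp [f]
    have hcast : ‖((ℓ - 1 : ℕ) : ℤ_[ℓ])‖ = 1 := by
      rw [PadicInt.norm_natCast_eq_one_iff]
      exact Nat.coprime_of_lt_prime (n := ℓ - 1) (p := ℓ) hn0 (by omega) Fact.out
    have hf' : ‖f.derivative.aeval (u : ℤ_[ℓ])‖ = 1 := by
      simp only [f, Polynomial.derivative_sub, Polynomial.derivative_X_pow,
        Polynomial.derivative_one, sub_zero, map_mul, Polynomial.aeval_C, map_pow,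
        Polynomial.aeval_X, Algebra.algebraMap_self, RingHom.id_apply, norm_mul, norm_pow, hu1,
        one_pow, mul_one]
      exact hcast
    have hlt : ‖f.aeval (u : ℤ_[ℓ])‖ < 1 := by
      rw [hf, PadicInt.norm_lt_one_iff_dvd, ← Ideal.mem_span_singleton,
        ← PadicInt.maximalIdeal_eq_span_p, ← PadicInt.ker_toZMod, RingHom.mem_ker, map_sub, map_pow,
        map_one, ZMod.pow_card_sub_one_eq_one, sub_self]
      exact (u.isUnit.map PadicInt.toZMod).ne_zero
    obtain ⟨z, hz, hzu, -⟩ := hensels_lemma (F := f) (a := (u : ℤ_[ℓ]))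
      (by rw [hf', one_pow]; exact hlt)
    rw [hf', PadicInt.norm_lt_one_iff_dvd] at hzu
    rw [hf, sub_eq_zero] at hz
    let z' : ℤ_[ℓ]ˣ := Units.ofPowEqOne z (ℓ - 1) hz hn0
    have hz' : (z' : ℤ_[ℓ]) = z := rfl
    refine ⟨u / z', ?_, ?_⟩
    · rw [mem_principalUnits]
      have h2u : IsUnit (2 : ℤ_[ℓ]) := by
        rw [PadicInt.isUnit_iff]
        have := (PadicInt.norm_natCast_eq_one_iff (p := ℓ) (n := 2)).2
          ((Nat.coprime_primes Fact.out Nat.prime_two).2 h2)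
        simpa using this
      rw [h2u.mul_left_dvd]
      have : ((u / z' : ℤ_[ℓ]ˣ) : ℤ_[ℓ]) - 1 = -((z'⁻¹ : ℤ_[ℓ]ˣ) : ℤ_[ℓ]) * (z - u) := by
        rw [div_eq_mul_inv, Units.val_mul, mul_sub, neg_mul, neg_mul, ← hz', Units.inv_mul]
        ring
      rw [this]
      exact hzu.mul_left _
    · rw [div_div_cancel]
      exact isOfFinOrder_iff_pow_eq_one.2 ⟨ℓ - 1, by omega, Units.ext (by
        rw [Units.val_pow_eq_pow_val, hz', hz, Units.val_one])⟩

theorem existsUnique_principalPart (u : ℤ_[ℓ]ˣ) :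
    ∃! v : principalUnits ℓ, IsOfFinOrder (u / (v : ℤ_[ℓ]ˣ)) := by
  obtain ⟨v, hv, hvu⟩ := exists_principalPart u
  refine ⟨⟨v, hv⟩, hvu, fun w hw => ?_⟩
  have h : (w : ℤ_[ℓ]ˣ) / v = 1 :=
    eq_one_of_isOfFinOrder (div_mem w.2 hv) (by
      have := hvu.mul (hw.inv)
      rwa [inv_div, div_mul_div_comm, mul_comm u, mul_div_mul_right_eq_div] at this)
  exact Subtype.ext (div_eq_one.1 h)

variable (ℓ)

/-- The projection `u ↦ ⟨u⟩` of `ℤ_ℓˣ` onto `1 + 2ℓℤ_ℓ` whose kernel is the group of roots of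
unity. -/
noncomputable def principalPart : ℤ_[ℓ]ˣ →* principalUnits ℓ where
  toFun u := (existsUnique_principalPart u).choose
  map_one' := ((existsUnique_principalPart (1 : ℤ_[ℓ]ˣ)).choose_spec.2 1 (by simp)).symm
  map_mul' a b := by
    refine ((existsUnique_principalPart (a * b)).choose_spec.2 _ ?_).symm
    have ha := (existsUnique_principalPart a).choose_spec.1
    have hb := (existsUnique_principalPart b).choose_spec.1
    have := ha.mul hb
    rwa [div_mul_div_comm] at this

/-- `u = ζ⟨u⟩` with `ζ` a root of unity. -/
theorem isOfFinOrder_div_principalPart (u : ℤ_[ℓ]ˣ) :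
    IsOfFinOrder (u / (principalPart ℓ u : ℤ_[ℓ]ˣ)) :=
  (existsUnique_principalPart u).choose_spec.1

/-- The unit part `y ↦ y ℓ^{-v_ℓ(y)}` of a nonzero `ℓ`-adic number. -/
noncomputable def unitPart : ℚ_[ℓ]ˣ →* ℤ_[ℓ]ˣ where
  toFun y := PadicInt.mkUnits (u := (y : ℚ_[ℓ]) * (ℓ : ℚ_[ℓ]) ^ (-(y : ℚ_[ℓ]).valuation)) (by
    have hl : (ℓ : ℝ) ≠ 0 := Nat.cast_ne_zero.2 (Fact.out : ℓ.Prime).ne_zero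
    rw [norm_mul, Padic.norm_eq_zpow_neg_valuation y.ne_zero, norm_zpow, Padic.norm_p, inv_zpow,
      ← zpow_neg, neg_neg, ← zpow_add₀ hl, neg_add_cancel, zpow_zero])
  map_one' := by
    refine Units.ext (PadicInt.ext ?_)
    simp
  map_mul' a b := by
    have hl : (ℓ : ℚ_[ℓ]) ≠ 0 := Nat.cast_ne_zero.2 (Fact.out : ℓ.Prime).ne_zero
    refine Units.ext (PadicInt.ext ?_)
    simp only [PadicInt.mkUnits_eq, Units.val_mul, PadicInt.coe_mul,
      Padic.valuation_mul a.ne_zero b.ne_zero, neg_add, zpow_add₀ hl]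
    ring

/-- The map `y ↦ ⟨y⟩` on `ℚ_ℓˣ`: the principal part of the unit part of `y`. On `ℤ_ℓˣ` it is the
projection onto `1 + 2ℓℤ_ℓ`. -/
noncomputable def bracket : ℚ_[ℓ]ˣ →* principalUnits ℓ :=
  (principalPart ℓ).comp (unitPart ℓ)

theorem bracket_coe (u : ℤ_[ℓ]ˣ) :
    bracket ℓ (Units.map (algebraMap ℤ_[ℓ] ℚ_[ℓ]).toMonoidHom u) = principalPart ℓ u := by
  have h : unitPart ℓ (Units.map (algebraMap ℤ_[ℓ] ℚ_[ℓ]).toMonoidHom u) = u := by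
    have hv : (u : ℤ_[ℓ]).valuation = 0 := by
      have h1 := PadicInt.norm_eq_zpow_neg_valuation u.ne_zero
      rw [PadicInt.norm_units] at h1
      have hl : (1 : ℝ) < ℓ := Nat.one_lt_cast.2 (Fact.out : ℓ.Prime).one_lt
      have := (zpow_eq_one_iff_right₀ (by positivity) hl.ne').1 h1.symm
      omega
    refine Units.ext (PadicInt.ext ?_)
    simp [unitPart, hv]
  exact congrArg (principalPart ℓ) h

end PrincipalUnits
section Places

open IsDedekindDomain NumberField

variable {ℓ : ℕ} [Fact ℓ.Prime] {K : Type*} [Field K] [NumberField K]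

variable (ℓ) in
/-- The prime ideal of `ℤ` generated by `ℓ`. -/
noncomputable abbrev ratPrime : HeightOneSpectrum ℤ :=
  (Rat.HeightOneSpectrum.primesEquiv (R := ℤ)).symm ⟨ℓ, Fact.out⟩

theorem mem_ratPrime : (ℓ : ℤ) ∈ (ratPrime ℓ).asIdeal := by
  have h := Rat.HeightOneSpectrum.natGenerator_dvd_iff (ratPrime ℓ) (n := ℓ)
  have h' : Rat.HeightOneSpectrum.natGenerator (ratPrime ℓ) = ℓ :=
    congrArg Subtype.val ((Rat.HeightOneSpectrum.primesEquiv (R := ℤ)).apply_symm_apply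
      ⟨ℓ, Fact.out⟩)
  rw [h'] at h
  have h2 := h.1 dvd_rfl
  rw [← map_natCast (Rat.IsIntegralClosure.intEquiv ℤ)] at h2
  exact (Ideal.apply_mem_of_equiv_iff (f := Rat.IsIntegralClosure.intEquiv ℤ)).1 h2

theorem liesOver_ratPrime {K : Type*} [Field K] {w : HeightOneSpectrum (𝓞 K)} (h : (ℓ : 𝓞 K) ∈ w.asIdeal) :
    w.asIdeal.LiesOver (ratPrime ℓ).asIdeal := by
  have hv : (ratPrime ℓ).asIdeal = Ideal.span {(ℓ : ℤ)} := by
    have hmax : (Ideal.span {(ℓ : ℤ)}).IsMaximal :=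
      Ideal.IsPrime.isMaximal ((Ideal.span_singleton_prime (by
        exact_mod_cast (Fact.out : ℓ.Prime).ne_zero)).2
        (Nat.prime_iff_prime_int.1 Fact.out)) (by
        simpa using (Fact.out : ℓ.Prime).ne_zero)
    exact (hmax.eq_of_le (ratPrime ℓ).isPrime.ne_top
      ((Ideal.span_singleton_le_iff_mem _).2 mem_ratPrime)).symm
  have hmax : (ratPrime ℓ).asIdeal.IsMaximal := (ratPrime ℓ).isMaximal
  refine ⟨hmax.eq_of_le (Ideal.IsPrime.under ℤ w.asIdeal).ne_top ?_⟩
  rw [hv, Ideal.span_singleton_le_iff_mem, Ideal.under_def, Ideal.mem_comap]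
  simpa using h

/-- For a place `w` of `K` above `ℓ`, the canonical embedding `ℚ_ℓ → K_w`: the continuous extension
of `ℚ → K_w`. -/
noncomputable def padicToCompletion (w : HeightOneSpectrum (𝓞 K)) (h : (ℓ : 𝓞 K) ∈ w.asIdeal) :
    ℚ_[ℓ] →+* w.adicCompletion K :=
  haveI := liesOver_ratPrime h
  ((HeightOneSpectrum.adicCompletion.equiv K w).symm.toRingHom.comp
    (UniformSpace.Completion.mapRingHom _
      (HeightOneSpectrum.uniformContinuous_algebraMap_liesOver ℚ K
        (ratPrime ℓ) w).continuous)).comp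
    ((HeightOneSpectrum.adicCompletion.equiv ℚ (ratPrime ℓ)).toRingHom.comp
      (Padic.adicCompletionEquiv ℤ ⟨ℓ, Fact.out⟩).toRingEquiv.toRingHom)

theorem continuous_padicToCompletion (w : HeightOneSpectrum (𝓞 K)) (h : (ℓ : 𝓞 K) ∈ w.asIdeal) :
    Continuous (padicToCompletion w h) :=
  ((HeightOneSpectrum.adicCompletion.uniformEquiv K w).symm.continuous.comp
    UniformSpace.Completion.continuous_map).comp
    ((HeightOneSpectrum.adicCompletion.uniformEquiv ℚ (ratPrime ℓ)).continuous.comp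
      (Padic.adicCompletionEquiv ℤ ⟨ℓ, Fact.out⟩).continuous)

theorem eq_padicToCompletion (w : HeightOneSpectrum (𝓞 K)) (h : (ℓ : 𝓞 K) ∈ w.asIdeal)
    (f : ℚ_[ℓ] →+* w.adicCompletion K) (hf : Continuous f) : f = padicToCompletion w h := by
  refine RingHom.ext fun x => congrFun ((Padic.denseRange_ratCast ℓ).equalizer hf
    (continuous_padicToCompletion w h) (funext fun q => ?_)) x
  simp

/-- The norm `N_{K_w/ℚ_ℓ}` of the local extension at a place `w` above `ℓ`, on `Kˣ`. -/
noncomputable def localNorm (w : HeightOneSpectrum (𝓞 K)) (h : (ℓ : 𝓞 K) ∈ w.asIdeal) :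
    Kˣ →* ℚ_[ℓ]ˣ :=
  letI := (padicToCompletion w h).toAlgebra
  (Units.map (Algebra.norm ℚ_[ℓ])).comp
    (Units.map (algebraMap K (w.adicCompletion K)).toMonoidHom)

/-- The homomorphism `x ↦ Nw^{-v_w(x)}` from `Kˣ` to the unit group of a field `M` of
characteristic zero; here `Nw` is the cardinality of the residue field at `w`. -/
noncomputable def normPow (M : Type*) [Field M] [CharZero M] (w : HeightOneSpectrum (𝓞 K)) :
    Kˣ →* Mˣ :=
  (zpowersHom Mˣ (Units.mk0 (Ideal.absNorm w.asIdeal : M)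
    (Nat.cast_ne_zero.2 (Ideal.absNorm_eq_zero_iff.not.2 w.ne_bot)))).comp w.valuationOfNeZero

open scoped Classical in
variable (ℓ) in
/-- The (non principal) `ℓ`-adic absolute value of `K` attached to a finite place `w`. Its values
lie in the torsion-free group `(1 + 2ℓℤ_ℓ) · ℓ^ℚ`, seen as a direct product; the factor `ℓ^ℚ` is
realized inside `ℝˣ`. -/
noncomputable def finiteAbs (w : HeightOneSpectrum (𝓞 K)) : Kˣ →* principalUnits ℓ × ℝˣ :=
  if h : (ℓ : 𝓞 K) ∈ w.asIdeal then
    ((bracket ℓ).comp (localNorm w h * normPow ℚ_[ℓ] w)).prod (normPow ℝ w)⁻¹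
  else
    ((bracket ℓ).comp (normPow ℚ_[ℓ] w)).prod 1

/-- The `ℓ`-adic absolute value `x ↦ ℓ^{-v_ℓ(φ(τ(x)))}` attached to an embedding `τ` of `K` in `ℂ`,
with respect to an embedding `φ` of `ℂ` in `ℂ_ℓ`. The norm of `ℂ_ℓ` is the one with `‖ℓ‖ = ℓ⁻¹`. -/
noncomputable def infiniteAbs (φ : ℂ →+* ℂ_[ℓ]) (τ : K →+* ℂ) : Kˣ →* principalUnits ℓ × ℝˣ :=
  (1 : Kˣ →* principalUnits ℓ).prod
    (Units.map ((normHom : ℂ_[ℓ] →*₀ ℝ).toMonoidHom.comp (φ.comp τ).toMonoidHom))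

variable (K) in
/-- The kernel `μ_K^{(ℓ)}` of all the `ℓ`-adic absolute values of `K`. -/
noncomputable def ladicKernel (φ : ℂ →+* ℂ_[ℓ]) : Subgroup Kˣ :=
  (⨅ w : HeightOneSpectrum (𝓞 K), (finiteAbs ℓ w).ker) ⊓ ⨅ τ : K →+* ℂ, (infiniteAbs φ τ).ker

end Places

section Transport

open IsDedekindDomain NumberField

variable {ℓ : ℕ} [Fact ℓ.Prime] {K L : Type*} [Field K] [NumberField K] [Field L] [NumberField L]
  (e : K ≃+* L) {v : HeightOneSpectrum (𝓞 K)} {w : HeightOneSpectrum (𝓞 L)}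

theorem transport_valuation (h : v.asIdeal = w.asIdeal.comap (RingOfIntegers.mapRingEquiv e))
    (x : K) : w.valuation L (e x) = v.valuation K x := by
  let := e.toRingHom.toAlgebra
  have : w.asIdeal.LiesOver v.asIdeal := ⟨h⟩
  have key := HeightOneSpectrum.valuation_liesOver L v w (K := K)
  obtain ⟨y, hy⟩ := w.valuation_surjective L (WithZero.exp (-1))
  have h1 := key (e.symm y)
  have hal : ∀ x, algebraMap K L x = e x := fun _ => rfl
  have : v.asIdeal.ramificationIdx' w.asIdeal = 1 := by
    rw [hal, e.apply_symm_apply, hy] at h1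
    have h2 := congrArg WithZero.log h1
    rw [WithZero.log_pow, WithZero.log_exp, nsmul_eq_mul] at h2
    have h3 := isUnit_of_dvd_one (Dvd.intro (-(v.valuation K (e.symm y)).log) (by
      rw [mul_neg, h2, neg_neg]) : ((v.asIdeal.ramificationIdx' w.asIdeal : ℕ) : ℤ) ∣ 1)
    exact Nat.isUnit_iff.1 (Int.ofNat_isUnit.1 h3)
  rw [← hal, ← key, this, pow_one]

theorem transport_absNorm (h : v.asIdeal = w.asIdeal.comap (RingOfIntegers.mapRingEquiv e)) :
    Ideal.absNorm v.asIdeal = Ideal.absNorm w.asIdeal := by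
  have h' : w.asIdeal = v.asIdeal.map (RingOfIntegers.mapRingEquiv e : 𝓞 K →+* 𝓞 L) := by
    rw [h]
    exact (Ideal.map_comap_of_surjective _ (RingOfIntegers.mapRingEquiv e).surjective _).symm
  rw [Ideal.absNorm_apply, Ideal.absNorm_apply, Submodule.cardQuot_apply, Submodule.cardQuot_apply]
  exact Nat.card_congr (Ideal.quotientEquiv _ _ (RingOfIntegers.mapRingEquiv e) h').toEquiv

theorem transport_continuous (h : v.asIdeal = w.asIdeal.comap (RingOfIntegers.mapRingEquiv e)) :
    Continuous (WithVal.congr (v.valuation K) (w.valuation L) e) := by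
  let := e.toRingHom.toAlgebra
  have : w.asIdeal.LiesOver v.asIdeal := ⟨h⟩
  exact (HeightOneSpectrum.uniformContinuous_algebraMap_liesOver K L v w).continuous

theorem transport_symm {K L : Type*} [Field K] [Field L] (e : K ≃+* L)
    {v : HeightOneSpectrum (𝓞 K)} {w : HeightOneSpectrum (𝓞 L)}
    (h : v.asIdeal = w.asIdeal.comap (RingOfIntegers.mapRingEquiv e)) :
    w.asIdeal = v.asIdeal.comap (RingOfIntegers.mapRingEquiv e.symm) := by
  ext x
  rw [h]
  simp only [Ideal.mem_comap]
  have : RingOfIntegers.mapRingEquiv e (RingOfIntegers.mapRingEquiv e.symm x) = x :=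
    RingOfIntegers.ext (by simp)
  rw [this]

/-- The isomorphism of completions `K_v ≃ L_w` induced by an isomorphism `K ≃ L` taking `v`
to `w`. -/
noncomputable def completionEquiv
    (h : v.asIdeal = w.asIdeal.comap (RingOfIntegers.mapRingEquiv e)) :
    v.adicCompletion K ≃+* w.adicCompletion L :=
  ((HeightOneSpectrum.adicCompletion.equiv K v).trans
    (UniformSpace.Completion.mapRingEquiv (WithVal.congr (v.valuation K) (w.valuation L) e)
      (transport_continuous e h) (transport_continuous e.symm (transport_symm e h)))).trans
    (HeightOneSpectrum.adicCompletion.equiv L w).symm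

theorem continuous_completionEquiv
    (h : v.asIdeal = w.asIdeal.comap (RingOfIntegers.mapRingEquiv e)) :
    Continuous (completionEquiv e h) :=
  ((HeightOneSpectrum.adicCompletion.uniformEquiv L w).symm.continuous.comp
    UniformSpace.Completion.continuous_map).comp
    (HeightOneSpectrum.adicCompletion.uniformEquiv K v).continuous

theorem completionEquiv_algebraMap
    (h : v.asIdeal = w.asIdeal.comap (RingOfIntegers.mapRingEquiv e)) (x : K) :
    completionEquiv e h (algebraMap K _ x) = algebraMap L _ (e x) := by
  refine HeightOneSpectrum.adicCompletion.ext _ _ ?_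
  exact UniformSpace.Completion.mapRingHom_coe (transport_continuous e h)
    (WithVal.toVal (v.valuation K) x)

theorem transport_localNorm (h : v.asIdeal = w.asIdeal.comap (RingOfIntegers.mapRingEquiv e))
    (hv : (ℓ : 𝓞 K) ∈ v.asIdeal) (hw : (ℓ : 𝓞 L) ∈ w.asIdeal) (x : Kˣ) :
    localNorm w hw (Units.map (e : K →* L) x) = localNorm v hv x := by
  let := (padicToCompletion v hv).toAlgebra
  let := (padicToCompletion w hw).toAlgebra
  ext
  change Algebra.norm ℚ_[ℓ] (algebraMap L (w.adicCompletion L) (e x)) =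
    Algebra.norm ℚ_[ℓ] (algebraMap K (v.adicCompletion K) x)
  rw [Algebra.norm_eq_of_equiv_equiv (RingEquiv.refl ℚ_[ℓ]) (completionEquiv e h) ?_
    (algebraMap K (v.adicCompletion K) x), completionEquiv_algebraMap]
  · rfl
  · symm
    exact eq_padicToCompletion w hw
      ((completionEquiv e h : v.adicCompletion K →+* w.adicCompletion L).comp
        (padicToCompletion v hv))
      ((continuous_completionEquiv e h).comp (continuous_padicToCompletion v hv))

theorem transport_normPow (M : Type*) [Field M] [CharZero M]
    (h : v.asIdeal = w.asIdeal.comap (RingOfIntegers.mapRingEquiv e)) (x : Kˣ) :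
    normPow M w (Units.map (e : K →* L) x) = normPow M v x := by
  have h1 : w.valuationOfNeZero (Units.map (e : K →* L) x) = v.valuationOfNeZero x := by
    rw [← WithZero.coe_inj, HeightOneSpectrum.valuationOfNeZero_eq,
      HeightOneSpectrum.valuationOfNeZero_eq]
    exact transport_valuation e h x
  ext
  simp [normPow, h1, transport_absNorm e h]

theorem transport_finiteAbs (h : v.asIdeal = w.asIdeal.comap (RingOfIntegers.mapRingEquiv e))
    (x : Kˣ) : finiteAbs ℓ w (Units.map (e : K →* L) x) = finiteAbs ℓ v x := by
  have hl : (ℓ : 𝓞 K) ∈ v.asIdeal ↔ (ℓ : 𝓞 L) ∈ w.asIdeal := by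
    rw [h, Ideal.mem_comap, map_natCast]
  by_cases hv : (ℓ : 𝓞 K) ∈ v.asIdeal
  · rw [finiteAbs, finiteAbs, dif_pos hv, dif_pos (hl.1 hv)]
    simp [transport_normPow e _ h, transport_localNorm e h hv (hl.1 hv)]
  · rw [finiteAbs, finiteAbs, dif_neg hv, dif_neg (hl.not.1 hv)]
    simp [transport_normPow e _ h]

theorem map_mem_ladicKernel (e : K ≃+* K) (φ : ℂ →+* ℂ_[ℓ]) {x : Kˣ} (hx : x ∈ ladicKernel K φ) :
    Units.map (e : K →* K) x ∈ ladicKernel K φ := by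
  simp only [ladicKernel, Subgroup.mem_inf, Subgroup.mem_iInf, MonoidHom.mem_ker] at hx ⊢
  refine ⟨fun w => ?_, fun τ => hx.2 (τ.comp e)⟩
  rw [← hx.1 (w.comap (RingOfIntegers.mapRingEquiv e : 𝓞 K →+* 𝓞 K)
    (RingOfIntegers.mapRingEquiv e).surjective)]
  exact transport_finiteAbs e rfl x

end Transport
section Galois

open IsDedekindDomain NumberField
open scoped TensorProduct

/-- A number field `F` is totally `ℓ`-adic if all its conjugates in an algebraic closure of `ℚ_ℓ`
are contained in `ℚ_ℓ`. -/
def IsTotallyLadic (ℓ : ℕ) [Fact ℓ.Prime] (F : Type*) [Field F] : Prop :=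
  ∀ (σ : F →+* PadicAlgCl ℓ) (x : F), σ x ∈ (algebraMap ℚ_[ℓ] (PadicAlgCl ℓ)).range

/-- The extension `K/F` is non-split above `ℓ` if over each place of `F` above `ℓ` there is exactly
one place of `K`. -/
def IsNonSplitAbove (ℓ : ℕ) (F K : Type*) [Field F] [NumberField F] [Field K] [NumberField K]
    [Algebra F K] : Prop :=
  ∀ v : HeightOneSpectrum (𝓞 F), (ℓ : 𝓞 F) ∈ v.asIdeal →
    ∃! w : HeightOneSpectrum (𝓞 K), w.asIdeal.LiesOver v.asIdeal

variable {ℓ : ℕ} [Fact ℓ.Prime] (F K : Type*) [Field F] [Field K] [NumberField K] [Algebra F K]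

/-- The action of an element of `Gal(K/F)` on `μ_K^{(ℓ)}`. -/
noncomputable def galKernelMap (φ : ℂ →+* ℂ_[ℓ]) (σ : Gal(K/F)) :
    ladicKernel K φ →* ladicKernel K φ :=
  ((Units.map (σ : K →* K)).comp (ladicKernel K φ).subtype).codRestrict _ fun x =>
    map_mem_ladicKernel σ.toRingEquiv φ x.2

/-- The `ℚ[G]`-module `ℚ ⊗ μ_K^{(ℓ)}`, where `G = Gal(K/F)`. -/
noncomputable def kernelRep (φ : ℂ →+* ℂ_[ℓ]) :
    Representation ℚ Gal(K/F) (ℚ ⊗[ℤ] Additive (ladicKernel K φ)) where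
  toFun σ := (galKernelMap F K φ σ).toAdditive.toIntLinearMap.baseChange ℚ
  map_one' := by
    ext x
    rfl
  map_mul' σ τ := by
    ext x
    rfl

/-- The character of a group `G` induced from the trivial character of a subgroup `D`. -/
noncomputable def inducedTrivialCharacter {G : Type*} [Group G] (D : Subgroup G) : G → ℚ :=
  (Representation.ind D.subtype (Representation.trivial ℚ D ℚ)).character

variable {K}

/-- The decomposition group in `Gal(K/F)` of an infinite place of `K`. -/
def decompositionGroup (w : InfinitePlace K) : Subgroup Gal(K/F) :=
  MulAction.stabilizer Gal(K/F) w

end Galois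

end LadicWeil

/-! Write n = |G| and N(x) for the product of the conjugates of x under G. The proof identifies the
kernel and then applies Dirichlet's unit theorem.

Trivial absolute values at the finite places force x to be a unit. For a unit, the only remaining
conditions are that the local norms to ℚ_ℓ at the places w above ℓ be roots of unity. As F is
totally ℓ-adic, its image in K_w lies in ℚ_ℓ; as w is alone above its place of F, all of G acts on
K_w. Hence K_w/ℚ_ℓ is Galois with group G and the local norm is N(x)
(`padicToCompletion_localNorm`). So the kernel consists of the units u with N(u) of finite order
(`mem_ladicKernel_iff`).

Let T be the sum of the elements of G acting on real functions on the infinite places of K.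
Logarithms map the kernel, modulo torsion, onto a lattice in ker T
(`discreteTopology_range_kernelLog`, `span_range_kernelLog`), so traces on ℚ ⊗ μ can be computed on
ker T. As T/n is a projector commuting with G, the trace of g on ker T is the number of infinite
places of K fixed by g minus the number of infinite places of F (`trace_placeMap_restrict`). The
fixed places, sorted by the place of F below, give the induced characters
(`sum_inducedTrivialCharacter`). -/

namespace LadicWeil

/-! ### Induced trivial characters as permutation characters -/

section PermutationCharacter

/-- The trace of a linear map permuting a basis is the number of fixed basis vectors. -/
theorem trace_eq_card_of_permutes_basis {k M ι : Type*} [CommRing k] [AddCommGroup M] [Module k M]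
    [Finite ι] (b : Module.Basis ι k M) (f : M →ₗ[k] M) (p : ι → ι) (h : ∀ i, f (b i) = b (p i)) :
    LinearMap.trace k M f = (Nat.card {i // p i = i} : k) := by
  classical
  have := Fintype.ofFinite ι
  rw [LinearMap.trace_eq_matrix_trace k b, Matrix.trace]
  simp only [Matrix.diag_apply, LinearMap.toMatrix_apply, h, Module.Basis.repr_self,
    Finsupp.single_apply]
  rw [Finset.sum_boole, Nat.card_eq_fintype_card, Fintype.card_subtype]

variable {G : Type*} [Group G] (D : Subgroup G)

open Representation TensorProduct

theorem indTrivial_mk_mul (d : D) (h : G) (a : ℚ) :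
    IndV.mk D.subtype (trivial ℚ D ℚ) (d * h) a = IndV.mk D.subtype (trivial ℚ D ℚ) h a := by
  have := Coinvariants.mk_self_apply
    (tprod ((leftRegular ℚ G).comp D.subtype) (trivial ℚ D ℚ)) d (MonoidAlgebra.single h 1 ⊗ₜ a)
  simpa using this

/-- The representation induced from the trivial representation of `D` is the permutation
representation on `G ⧸ D`. -/
noncomputable def indTrivialEquiv :
    IndV D.subtype (trivial ℚ D ℚ) ≃ₗ[ℚ] (G ⧸ D →₀ ℚ) :=
  LinearEquiv.ofLinearMap
    (Coinvariants.lift _ (TensorProduct.lift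
      ((Finsupp.lsum ℚ fun h : G => LinearMap.toSpanSingleton ℚ (ℚ →ₗ[ℚ] (G ⧸ D →₀ ℚ))
        -- The generators of `IndV` are constant on right cosets Dh, whereas `G ⧸ D` consists of
        -- left cosets; inversion exchanges the two.
        (Finsupp.lsingle ((h⁻¹ : G) : G ⧸ D))) ∘ₗ
        (MonoidAlgebra.coeffLinearEquiv ℚ).toLinearMap)) fun d => by
        ext h
        simp)
    (Finsupp.lsum ℚ fun q => IndV.mk D.subtype (trivial ℚ D ℚ) q.out⁻¹)
    (by ext q; simp)
    (by
      refine IndV.hom_ext _ _ fun h => LinearMap.ext fun a => ?_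
      obtain ⟨d, hd⟩ := QuotientGroup.mk_out_eq_mul D h⁻¹
      have := indTrivial_mk_mul D d⁻¹ h a
      simpa [hd] using this)

theorem indTrivialEquiv_symm_single (h : G) (a : ℚ) :
    (indTrivialEquiv D).symm (Finsupp.single (h : G ⧸ D) a) =
      IndV.mk D.subtype (trivial ℚ D ℚ) h⁻¹ a := by
  rw [LinearEquiv.symm_apply_eq]
  simp [indTrivialEquiv]

theorem inducedTrivialCharacter_eq_card [Finite G] (g : G) :
    inducedTrivialCharacter D g = Nat.card {x : G ⧸ D // g • x = x} := by
  refine trace_eq_card_of_permutes_basis (Module.Basis.ofRepr (indTrivialEquiv D)) _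
    (fun x => g • x) fun x => ?_
  obtain ⟨h, rfl⟩ := QuotientGroup.mk_surjective x
  simp only [Module.Basis.coe_ofRepr]
  -- The induced action multiplies on the right by g⁻¹; after inversion this is left translation by
  -- g.
  rw [indTrivialEquiv_symm_single, ind_mk, ← mul_inv_rev, ← indTrivialEquiv_symm_single]
  rfl

/-- The fixed points of `g` on a `G`-set, counted orbit by orbit. -/
theorem sum_card_fixed_quotient_stabilizer {X Y : Type*} [MulAction G X] [Finite X] [Fintype Y]
    (π : X → Y) (hπ : ∀ a b, π a = π b → a ∈ MulAction.orbit G b)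
    (hG : ∀ (g : G) a, π (g • a) = π a) (s : Y → X) (hs : ∀ y, π (s y) = y) (g : G) :
    ∑ y, Nat.card {x : G ⧸ MulAction.stabilizer G (s y) // g • x = x} =
      Nat.card {a : X // g • a = a} := by
  have hfin (y : Y) : Finite (G ⧸ MulAction.stabilizer G (s y)) :=
    Finite.of_injective _ (MulAction.injective_ofQuotientStabilizer G (s y))
  rw [← Nat.card_sigma]
  -- By `hπ` and `hG` each fibre of π is a single orbit, so X is the disjoint union of the G-sets
  -- G/Stab(s y); restrict this to the points fixed by g.
  refine Nat.card_congr (Equiv.ofBijective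
    (fun p => ⟨MulAction.ofQuotientStabilizer G (s p.1) p.2.1, ?_⟩) ⟨?_, ?_⟩)
  · rw [← MulAction.ofQuotientStabilizer_smul, p.2.2]
  · have key (y : Y) (x : G ⧸ MulAction.stabilizer G (s y)) :
        π (MulAction.ofQuotientStabilizer G (s y) x) = y := by
      induction x using QuotientGroup.induction_on with
      | H h => rw [MulAction.ofQuotientStabilizer_mk, hG, hs]
    rintro ⟨y, x, hx⟩ ⟨y', x', hx'⟩ h
    have h' := congrArg Subtype.val h
    dsimp only at h'
    obtain rfl : y = y' := by rw [← key y x, h', key]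
    obtain rfl := MulAction.injective_ofQuotientStabilizer G _ h'
    rfl
  · rintro ⟨a, ha⟩
    obtain ⟨h, hh⟩ := hπ a (s (π a)) (hs _).symm
    have hfix : g • (h : G ⧸ MulAction.stabilizer G (s (π a))) = h := by
      apply MulAction.injective_ofQuotientStabilizer G (s (π a))
      rw [MulAction.ofQuotientStabilizer_smul, MulAction.ofQuotientStabilizer_mk]
      exact (congrArg (g • ·) hh).trans (ha.trans hh.symm)
    exact ⟨⟨π a, (h : G ⧸ MulAction.stabilizer G (s (π a))), hfix⟩, Subtype.ext hh⟩

-- Since K/F is Galois, the infinite places of K above a given place of F form one orbit.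
open NumberField in
theorem sum_inducedTrivialCharacter (F K : Type*) [Field F] [NumberField F] [Field K]
    [NumberField K] [Algebra F K] [IsGalois F K] (w : InfinitePlace F → InfinitePlace K)
    (hw : ∀ v, (w v).comap (algebraMap F K) = v) (g : Gal(K/F)) :
    ∑ v, inducedTrivialCharacter (decompositionGroup F (w v)) g =
      Nat.card {u : InfinitePlace K // g • u = u} := by
  have : FiniteDimensional F K := Module.Finite.of_restrictScalars_finite ℚ F K
  simp only [inducedTrivialCharacter_eq_card]
  rw [← sum_card_fixed_quotient_stabilizer (fun u : InfinitePlace K => u.comap (algebraMap F K))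
    (fun a b h => InfinitePlace.mem_orbit_iff.2 h.symm)
    (fun g a => (InfinitePlace.mem_orbit_iff.1 ⟨g, rfl⟩).symm) w hw g]
  push_cast
  rfl

end PermutationCharacter
-- The local norm above ℓ is the global norm of K/F
section LocalNorm

open IsDedekindDomain NumberField

/-- An automorphism over F preserves the place below, so uniqueness makes w stable under all of
Gal(K/F). -/
theorem asIdeal_eq_comap_of_unique {F K : Type*} [Field F] [Field K] [Algebra F K]
    {v : HeightOneSpectrum (𝓞 F)}
    (hv : ∃! w : HeightOneSpectrum (𝓞 K), w.asIdeal.LiesOver v.asIdeal)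
    {w : HeightOneSpectrum (𝓞 K)} (hw : w.asIdeal.LiesOver v.asIdeal) (σ : Gal(K/F)) :
    w.asIdeal = w.asIdeal.comap (RingOfIntegers.mapRingEquiv σ.toRingEquiv) := by
  let w' := w.comap (RingOfIntegers.mapRingEquiv σ.toRingEquiv : 𝓞 K →+* 𝓞 K)
    (RingOfIntegers.mapRingEquiv σ.toRingEquiv).surjective
  have : w'.asIdeal.LiesOver v.asIdeal := by
    refine ⟨?_⟩
    rw [hw.over]
    ext x
    change algebraMap (𝓞 F) (𝓞 K) x ∈ w.asIdeal ↔
      RingOfIntegers.mapRingEquiv σ.toRingEquiv (algebraMap (𝓞 F) (𝓞 K) x) ∈ w.asIdeal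
    have : RingOfIntegers.mapRingEquiv σ.toRingEquiv (algebraMap (𝓞 F) (𝓞 K) x) =
      algebraMap (𝓞 F) (𝓞 K) x := RingOfIntegers.ext (σ.commutes (x : F))
    rw [this]
  exact congrArg HeightOneSpectrum.asIdeal (hv.unique hw this)

/-- The place of `F` below a place of `K`. -/
theorem exists_liesOver {F K : Type*} [Field F] [Field K] [NumberField K] [Algebra F K]
    (w : HeightOneSpectrum (𝓞 K)) :
    ∃ v : HeightOneSpectrum (𝓞 F), w.asIdeal.LiesOver v.asIdeal :=
  ⟨w.under (𝓞 F), ⟨rfl⟩⟩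

theorem IsNonSplitAbove.asIdeal_eq_comap {ℓ : ℕ} {F K : Type*} [Field F] [NumberField F]
    [Field K] [NumberField K] [Algebra F K] (hK : IsNonSplitAbove ℓ F K) (w : HeightOneSpectrum (𝓞 K))
    (h : (ℓ : 𝓞 K) ∈ w.asIdeal) (σ : Gal(K/F)) :
    w.asIdeal = w.asIdeal.comap (RingOfIntegers.mapRingEquiv σ.toRingEquiv) := by
  obtain ⟨v, hv⟩ := exists_liesOver (F := F) w
  refine asIdeal_eq_comap_of_unique (hK v ?_) hv σ
  rw [hv.over, Ideal.under_def, Ideal.mem_comap, map_natCast]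
  exact h

variable {ℓ : ℕ} [Fact ℓ.Prime]

/-- The roots in the algebraic closure are the images of x under the embeddings of F, and these all
lie in ℚ_ℓ. -/
theorem IsTotallyLadic.splits_minpoly {F : Type*} [Field F] [NumberField F]
    (hF : IsTotallyLadic ℓ F) (x : F) :
    ((minpoly ℚ x).map (algebraMap ℚ ℚ_[ℓ])).Splits := by
  refine Polynomial.Splits.of_splits_map_of_injective
    (algebraMap ℚ_[ℓ] (PadicAlgCl ℓ)).injective (IsAlgClosed.splits _) fun r hr => ?_
  rw [Polynomial.map_map, ← IsScalarTower.algebraMap_eq] at hr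
  have hr' : r ∈ (minpoly ℚ x).rootSet (PadicAlgCl ℓ) :=
    by classical exact Multiset.mem_toFinset.2 hr
  rw [← Embeddings.range_eval_eq_rootSet_minpoly F (PadicAlgCl ℓ) x] at hr'
  obtain ⟨σ, rfl⟩ := hr'
  exact hF σ x

variable {F K : Type*} [Field F] [NumberField F] [Field K] [NumberField K] [Algebra F K]

/-- The image of x in K_w is a root of a polynomial that already splits over ℚ_ℓ. This replaces any
use of the completion of F. -/
theorem IsTotallyLadic.algebraMap_mem_range (hF : IsTotallyLadic ℓ F) (w : HeightOneSpectrum (𝓞 K))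
    (h : (ℓ : 𝓞 K) ∈ w.asIdeal) (x : F) :
    algebraMap K (w.adicCompletion K) (algebraMap F K x) ∈ (padicToCompletion w h).range := by
  have hne : (minpoly ℚ x).map (algebraMap ℚ ℚ_[ℓ]) ≠ 0 :=
    Polynomial.map_ne_zero (minpoly.ne_zero (Algebra.IsIntegral.isIntegral x))
  let := (padicToCompletion w h).toAlgebra
  refine (hF.splits_minpoly x).mem_range_of_isRoot hne ?_
  have hmap : ((algebraMap ℚ_[ℓ] (w.adicCompletion K)).comp (algebraMap ℚ ℚ_[ℓ])) =
      ((algebraMap K (w.adicCompletion K)).comp (algebraMap F K)).comp (algebraMap ℚ F) :=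
    Subsingleton.elim _ _
  rw [Polynomial.map_map]
  change Polynomial.IsRoot (Polynomial.map ((algebraMap ℚ_[ℓ] (w.adicCompletion K)).comp _) _) _
  rw [hmap, ← Polynomial.map_map]
  refine Polynomial.IsRoot.map (f := (algebraMap K (w.adicCompletion K)).comp (algebraMap F K)) ?_
  rw [Polynomial.IsRoot, Polynomial.eval_map_algebraMap]
  exact minpoly.aeval ℚ x

/-- If `F` is totally `ℓ`-adic, an `F`-basis of `K` generates `K_w` over `ℚ_ℓ`. -/
theorem span_range_basis_eq_top (hF : IsTotallyLadic ℓ F) (w : HeightOneSpectrum (𝓞 K))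
    (h : (ℓ : 𝓞 K) ∈ w.asIdeal) {ι : Type*} [Finite ι] (b : Module.Basis ι F K) :
    letI := (padicToCompletion w h).toAlgebra
    Submodule.span ℚ_[ℓ] (Set.range fun i => algebraMap K (w.adicCompletion K) (b i)) = ⊤ := by
  let := (padicToCompletion w h).toAlgebra
  have : ContinuousSMul ℚ_[ℓ] (w.adicCompletion K) :=
    ⟨((continuous_padicToCompletion w h).comp continuous_fst).mul continuous_snd⟩
  set S := Submodule.span ℚ_[ℓ] (Set.range fun i => algebraMap K (w.adicCompletion K) (b i))
  have : FiniteDimensional ℚ_[ℓ] S := FiniteDimensional.span_of_finite _ (Set.finite_range _)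
  -- A finite-dimensional subspace is closed, and this one contains the dense subfield K.
  have hcl : IsClosed (S : Set (w.adicCompletion K)) := S.closed_of_finiteDimensional
  have hK : Set.range (algebraMap K (w.adicCompletion K)) ⊆ S := by
    rintro _ ⟨x, rfl⟩
    have := Fintype.ofFinite ι
    rw [← b.sum_repr x, map_sum]
    refine sum_mem fun i _ => ?_
    obtain ⟨y, hy⟩ := hF.algebraMap_mem_range w h (b.repr x i)
    rw [Algebra.smul_def, map_mul, ← hy]
    exact S.smul_mem y (Submodule.subset_span ⟨i, rfl⟩)
  refine SetLike.coe_injective ?_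
  rw [← hcl.closure_eq]
  exact ((w.denseRange_algebraMap K).mono hK).closure_eq

/-- The automorphism of `K_w` over `ℚ_ℓ` induced by an automorphism fixing `w`. -/
noncomputable def decompositionAut (w : HeightOneSpectrum (𝓞 K))
    (h : (ℓ : 𝓞 K) ∈ w.asIdeal) (σ : Gal(K/F))
    (hσ : w.asIdeal = w.asIdeal.comap (RingOfIntegers.mapRingEquiv σ.toRingEquiv)) :
    letI := (padicToCompletion w h).toAlgebra
    w.adicCompletion K ≃ₐ[ℚ_[ℓ]] w.adicCompletion K :=
  letI := (padicToCompletion w h).toAlgebra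
  -- Linearity over ℚ_ℓ is automatic: there is only one continuous homomorphism from ℚ_ℓ to K_w.
  AlgEquiv.ofRingEquiv (f := completionEquiv σ.toRingEquiv hσ) fun x =>
    congrArg (fun f : ℚ_[ℓ] →+* w.adicCompletion K => f x) (eq_padicToCompletion w h
      ((completionEquiv σ.toRingEquiv hσ : w.adicCompletion K →+* w.adicCompletion K).comp
        (padicToCompletion w h))
      ((continuous_completionEquiv σ.toRingEquiv hσ).comp (continuous_padicToCompletion w h)))

/-- If `F` is totally `ℓ`-adic and `K/F` is Galois and non-split above `ℓ`, then the local norms at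
the places of `K` above `ℓ` are all given by the norm of `K/F`. -/
theorem padicToCompletion_localNorm [IsGalois F K] [Fintype Gal(K/F)]
    (hF : IsTotallyLadic ℓ F) (hK : IsNonSplitAbove ℓ F K)
    (w : HeightOneSpectrum (𝓞 K)) (h : (ℓ : 𝓞 K) ∈ w.asIdeal) (x : Kˣ) :
    padicToCompletion w h (localNorm w h x) =
      algebraMap K (w.adicCompletion K) (∏ σ : Gal(K/F), σ (x : K)) := by
  classical
  let := (padicToCompletion w h).toAlgebra
  have : FiniteDimensional F K := Module.Finite.of_restrictScalars_finite ℚ F K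
  let b := Module.finBasis F K
  have hspan := span_range_basis_eq_top hF w h b
  have hfin : FiniteDimensional ℚ_[ℓ] (w.adicCompletion K) :=
    ⟨hspan ▸ Submodule.fg_span (Set.finite_range _)⟩
  have hle : Module.finrank ℚ_[ℓ] (w.adicCompletion K) ≤ Module.finrank F K := by
    rw [← finrank_top ℚ_[ℓ] (w.adicCompletion K), ← hspan]
    exact (finrank_range_le_card _).trans (by simp)
  let f (σ : Gal(K/F)) : Gal((w.adicCompletion K)/ℚ_[ℓ]) :=
    decompositionAut w h σ (hK.asIdeal_eq_comap w h σ)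
  have hf (σ : Gal(K/F)) (y : K) :
      f σ (algebraMap K (w.adicCompletion K) y) = algebraMap K (w.adicCompletion K) (σ y) :=
    completionEquiv_algebraMap σ.toRingEquiv (hK.asIdeal_eq_comap w h σ) y
  have hinj : Function.Injective f := fun σ τ hστ => AlgEquiv.ext fun y =>
    (algebraMap K (w.adicCompletion K)).injective (by rw [← hf, ← hf, hστ])
  have hcard : Nat.card Gal(K/F) = Module.finrank F K := IsGalois.card_aut_eq_finrank F K
  have hcard_le : Nat.card Gal(K/F) ≤ Nat.card Gal((w.adicCompletion K)/ℚ_[ℓ]) :=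
    Nat.card_le_card_of_injective f hinj
  have haut : Nat.card Gal((w.adicCompletion K)/ℚ_[ℓ]) ≤
      Module.finrank ℚ_[ℓ] (w.adicCompletion K) := by
    rw [Nat.card_eq_fintype_card]
    exact AlgEquiv.card_le
  -- The inequalities |Gal(K/F)| ≤ |Aut(K_w/ℚ_ℓ)| ≤ [K_w : ℚ_ℓ] ≤ [K : F] = |Gal(K/F)| are all
  -- equalities.
  have hbij : Function.Bijective f := (Nat.bijective_iff_injective_and_card f).2 ⟨hinj, by omega⟩
  have : IsGalois ℚ_[ℓ] (w.adicCompletion K) := IsGalois.of_card_aut_eq_finrank _ _ (by omega)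
  rw [map_prod]
  refine (Algebra.norm_eq_prod_automorphisms ℚ_[ℓ]
    (algebraMap K (w.adicCompletion K) (x : K))).trans ?_
  rw [← hbij.prod_comp (fun τ => τ (algebraMap K (w.adicCompletion K) (x : K)))]
  exact Finset.prod_congr rfl fun σ _ => hf σ x

end LocalNorm
-- The kernel as the units whose norm to F has finite order
section KernelCharacterization

open IsDedekindDomain NumberField

variable {ℓ : ℕ} [Fact ℓ.Prime]

/-- Each u/⟨u⟩ has finite order, and 1 + 2ℓℤ_ℓ is torsion-free. -/
theorem bracket_eq_one_iff (y : ℚ_[ℓ]ˣ) : bracket ℓ y = 1 ↔ IsOfFinOrder (unitPart ℓ y) := by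
  refine ⟨fun h => ?_, fun h => ?_⟩
  · have := isOfFinOrder_div_principalPart ℓ (unitPart ℓ y)
    rwa [show principalPart ℓ (unitPart ℓ y) = 1 from h, OneMemClass.coe_one, div_one] at this
  · have h' : IsOfFinOrder ((principalUnits ℓ).subtype (bracket ℓ y)) :=
      ((principalUnits ℓ).subtype.comp (principalPart ℓ)).isOfFinOrder h
    exact Subtype.ext (eq_one_of_isOfFinOrder (bracket ℓ y).2 h')

theorem bracket_eq_one_of_isOfFinOrder {y : ℚ_[ℓ]ˣ} (hy : IsOfFinOrder y) : bracket ℓ y = 1 :=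
  (bracket_eq_one_iff y).2 ((unitPart ℓ).isOfFinOrder hy)

/-- An element of the kernel of `⟨·⟩` is a root of unity up to powers of `ℓ`. -/
theorem exists_pow_eq_zpow_of_bracket_eq_one {y : ℚ_[ℓ]ˣ} (hy : bracket ℓ y = 1) :
    ∃ m : ℕ, 0 < m ∧ ∃ j : ℤ, (y : ℚ_[ℓ]) ^ m = (ℓ : ℚ_[ℓ]) ^ j := by
  obtain ⟨m, hm, h⟩ := isOfFinOrder_iff_pow_eq_one.1 ((bracket_eq_one_iff y).1 hy)
  have hl : (ℓ : ℚ_[ℓ]) ≠ 0 := Nat.cast_ne_zero.2 (Fact.out : ℓ.Prime).ne_zero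
  refine ⟨m, hm, (y : ℚ_[ℓ]).valuation * m, ?_⟩
  have h' := congrArg (fun u : ℤ_[ℓ]ˣ => ((u : ℤ_[ℓ]) : ℚ_[ℓ])) h
  simp only [unitPart, MonoidHom.coe_mk, OneHom.coe_mk, Units.val_pow_eq_pow_val,
    PadicInt.mkUnits_eq, PadicInt.coe_pow, Units.val_one, PadicInt.coe_one] at h'
  rw [mul_pow, zpow_neg, inv_pow, mul_inv_eq_one₀ (pow_ne_zero _ (zpow_ne_zero _ hl))] at h'
  rw [h', zpow_mul, zpow_natCast]

variable {K : Type*} [Field K] [NumberField K]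

theorem normPow_eq_one_of_valuationOfNeZero_eq_one (M : Type*) [Field M] [CharZero M]
    {w : HeightOneSpectrum (𝓞 K)} {x : Kˣ} (h : w.valuationOfNeZero x = 1) :
    normPow M w x = 1 := by
  rw [normPow, MonoidHom.comp_apply, h, map_one]

theorem normPow_coe (M : Type*) [Field M] [CharZero M] (w : HeightOneSpectrum (𝓞 K)) (x : Kˣ) :
    (normPow M w x : M) =
      (Ideal.absNorm w.asIdeal : M) ^ (Multiplicative.toAdd (w.valuationOfNeZero x)) := by
  simp [normPow, zpowersHom_apply]

theorem one_lt_absNorm (w : HeightOneSpectrum (𝓞 K)) : 1 < Ideal.absNorm w.asIdeal := by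
  have h0 : Ideal.absNorm w.asIdeal ≠ 0 := Ideal.absNorm_eq_zero_iff.not.2 w.ne_bot
  have h1 : Ideal.absNorm w.asIdeal ≠ 1 := Ideal.absNorm_eq_one_iff.not.2 w.isPrime.ne_top
  omega

theorem valuationOfNeZero_eq_one_of_normPow_real {w : HeightOneSpectrum (𝓞 K)} {x : Kˣ}
    (h : normPow ℝ w x = 1) : w.valuationOfNeZero x = 1 := by
  have h' := normPow_coe ℝ w x
  rw [h, Units.val_one, eq_comm, zpow_eq_one_iff_right₀ (by positivity)
    (by exact_mod_cast (one_lt_absNorm w).ne')] at h'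
  exact h'

/-- Otherwise a positive power of the residue cardinality Nw would be a power of ℓ. As Nw lies in
the prime ideal w, so would ℓ. -/
theorem valuationOfNeZero_eq_one_of_bracket {w : HeightOneSpectrum (𝓞 K)}
    (hw : (ℓ : 𝓞 K) ∉ w.asIdeal) {x : Kˣ} (h : bracket ℓ (normPow ℚ_[ℓ] w x) = 1) :
    w.valuationOfNeZero x = 1 := by
  obtain ⟨m, hm, j, hj⟩ := exists_pow_eq_zpow_of_bracket_eq_one h
  rw [normPow_coe] at hj
  set k := Multiplicative.toAdd (w.valuationOfNeZero x)
  set N := Ideal.absNorm w.asIdeal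
  by_contra hne
  have hk : k ≠ 0 := hne
  have hN : 1 < N := one_lt_absNorm w
  have hl : 1 < ℓ := (Fact.out : ℓ.Prime).one_lt
  have hQ : (N : ℚ) ^ (k * m) = (ℓ : ℚ) ^ j := by
    have : (algebraMap ℚ ℚ_[ℓ]) ((N : ℚ) ^ (k * m)) = algebraMap ℚ ℚ_[ℓ] ((ℓ : ℚ) ^ j) := by
      rw [map_zpow₀, map_zpow₀, map_natCast, map_natCast, zpow_mul, zpow_natCast, hj]
    exact (algebraMap ℚ ℚ_[ℓ]).injective this
  have key : ∀ a : ℕ, a ≠ 0 → ∀ i : ℤ, (N : ℚ) ^ a = (ℓ : ℚ) ^ i → False := by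
    intro a ha i hi
    have h1 : (1 : ℚ) < (ℓ : ℚ) ^ i := hi ▸ one_lt_pow₀ (by exact_mod_cast hN) ha
    have hi0 : 0 < i := (one_lt_zpow_iff_right₀ (by exact_mod_cast hl)).1 h1
    lift i to ℕ using hi0.le
    rw [zpow_natCast] at hi
    have hi' : N ^ a = ℓ ^ i := by exact_mod_cast hi
    have hmem : ((ℓ : 𝓞 K)) ^ i ∈ w.asIdeal := by
      have : ((N ^ a : ℕ) : 𝓞 K) ∈ w.asIdeal := by
        rw [Nat.cast_pow]
        exact Ideal.pow_mem_of_mem _ (Ideal.absNorm_mem _) _ (Nat.pos_of_ne_zero ha)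
      rw [hi'] at this
      simpa using this
    exact hw (w.isPrime.mem_of_pow_mem _ hmem)
  have hkm : k * m ≠ 0 := mul_ne_zero hk (by omega)
  -- `key` needs a positive exponent on Nw; if k * m is negative, invert both sides.
  rcases Int.natAbs_eq (k * m) with h1 | h1
  · exact key (k * m).natAbs (by omega) j (by rw [← hQ, ← zpow_natCast, ← h1])
  · refine key (k * m).natAbs (by omega) (-j) ?_
    rw [zpow_neg, ← hQ, ← zpow_neg, ← zpow_natCast]
    congr 1
    omega

/-- Above ℓ the valuation is read off the real factor; away from ℓ, off the factor in 1 + 2ℓℤ_ℓ. -/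
theorem valuationOfNeZero_eq_one_of_mem_ladicKernel {φ : ℂ →+* ℂ_[ℓ]} {x : Kˣ}
    (hx : x ∈ ladicKernel K φ) (w : HeightOneSpectrum (𝓞 K)) : w.valuationOfNeZero x = 1 := by
  simp only [ladicKernel, Subgroup.mem_inf, Subgroup.mem_iInf, MonoidHom.mem_ker] at hx
  have h := hx.1 w
  by_cases hw : (ℓ : 𝓞 K) ∈ w.asIdeal
  · rw [finiteAbs, dif_pos hw] at h
    exact valuationOfNeZero_eq_one_of_normPow_real (inv_eq_one.1 (congrArg Prod.snd h))
  · rw [finiteAbs, dif_neg hw] at h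
    exact valuationOfNeZero_eq_one_of_bracket hw (congrArg Prod.fst h)

theorem exists_unit_of_valuationOfNeZero_eq_one {x : Kˣ}
    (hx : ∀ w : HeightOneSpectrum (𝓞 K), w.valuationOfNeZero x = 1) :
    ∃ u : (𝓞 K)ˣ, Units.map (algebraMap (𝓞 K) K : 𝓞 K →* K) u = x := by
  have hv (w : HeightOneSpectrum (𝓞 K)) : w.valuation K (x : K) = 1 := by
    rw [← HeightOneSpectrum.valuationOfNeZero_eq, hx, WithZero.coe_one]
  obtain ⟨a, ha⟩ := HeightOneSpectrum.mem_integers_of_valuation_le_one K (x : K) fun w => (hv w).le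
  obtain ⟨b, hb⟩ := HeightOneSpectrum.mem_integers_of_valuation_le_one K ((x⁻¹ : Kˣ) : K)
    fun w => by rw [Units.val_inv_eq_inv_val, map_inv₀, hv, inv_one]
  have hab : a * b = 1 := by
    apply FaithfulSMul.algebraMap_injective (𝓞 K) K
    rw [map_mul, ha, hb, map_one, Units.mul_inv]
  exact ⟨⟨a, b, hab, by rw [mul_comm, hab]⟩, Units.ext ha⟩

variable (ℓ K) in
theorem exists_place_above : ∃ w : HeightOneSpectrum (𝓞 K), (ℓ : 𝓞 K) ∈ w.asIdeal := by
  have hmax : (ratPrime ℓ).asIdeal.IsMaximal := (ratPrime ℓ).isMaximal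
  have hker : RingHom.ker (algebraMap ℤ (𝓞 K)) ≤ (ratPrime ℓ).asIdeal := by
    rw [(RingHom.injective_iff_ker_eq_bot _).1 (FaithfulSMul.algebraMap_injective ℤ (𝓞 K))]
    exact bot_le
  obtain ⟨Q, hQ, hQc⟩ := Ideal.exists_ideal_over_maximal_of_isIntegral (ratPrime ℓ).asIdeal hker
  have hl : (ℓ : 𝓞 K) ∈ Q := by
    have := mem_ratPrime (ℓ := ℓ)
    rw [← hQc, Ideal.mem_comap] at this
    simpa using this
  refine ⟨⟨Q, hQ.isPrime, fun h => ?_⟩, hl⟩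
  rw [h, Ideal.mem_bot] at hl
  exact (Fact.out : ℓ.Prime).ne_zero (by exact_mod_cast hl)

/-- The valuation ring of ℂ_ℓ is integrally closed. -/
theorem norm_le_one_of_ringOfIntegers {K : Type*} [Field K] (f : K →+* ℂ_[ℓ]) (a : 𝓞 K) :
    ‖f a‖ ≤ 1 := by
  let v : Valuation ℂ_[ℓ] NNReal := NormedField.valuation
  obtain ⟨p, hp, hpa⟩ := a.isIntegral_coe
  refine (Valuation.integer.integers v).mem_of_integral ⟨p.map (Int.castRingHom _), hp.map _, ?_⟩
  rw [Polynomial.eval₂_map, RingHom.ext_int ((algebraMap v.integer ℂ_[ℓ]).comp _)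
    (f.comp (algebraMap ℤ K)), ← Polynomial.hom_eval₂, hpa, map_zero]

theorem infiniteAbs_unit {K : Type*} [Field K] (φ : ℂ →+* ℂ_[ℓ]) (τ : K →+* ℂ) (u : (𝓞 K)ˣ) :
    infiniteAbs φ τ (Units.map (algebraMap (𝓞 K) K : 𝓞 K →* K) u) = 1 := by
  have hle (u : (𝓞 K)ˣ) : ‖φ (τ (algebraMap (𝓞 K) K (u : 𝓞 K)))‖ ≤ 1 :=
    norm_le_one_of_ringOfIntegers (φ.comp τ) u
  have h : ‖φ (τ (algebraMap (𝓞 K) K (u : 𝓞 K)))‖ *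
      ‖φ (τ (algebraMap (𝓞 K) K ((u⁻¹ : (𝓞 K)ˣ) : 𝓞 K)))‖ = 1 := by
    rw [← norm_mul, ← map_mul, ← map_mul, ← map_mul, Units.mul_inv, map_one, map_one, map_one,
      norm_one]
  have h1 : ‖φ (τ (algebraMap (𝓞 K) K (u : 𝓞 K)))‖ = 1 := by
    refine le_antisymm (hle u) ?_
    rw [← h]
    exact mul_le_of_le_one_right (norm_nonneg _) (hle u⁻¹)
  exact Prod.ext rfl (Units.ext h1)

variable {F : Type*} [Field F] [NumberField F] [Algebra F K] [IsGalois F K] [Fintype Gal(K/F)]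

/-- `μ_K^{(ℓ)}` is the group of the units of `K` whose norm to `F` is a root of unity. -/
theorem mem_ladicKernel_iff (hF : IsTotallyLadic ℓ F) (hK : IsNonSplitAbove ℓ F K)
    (φ : ℂ →+* ℂ_[ℓ]) (x : Kˣ) :
    x ∈ ladicKernel K φ ↔ ∃ u : (𝓞 K)ˣ, Units.map (algebraMap (𝓞 K) K : 𝓞 K →* K) u = x ∧
      IsOfFinOrder (∏ σ : Gal(K/F), Units.map (σ : K →* K) x) := by
  have hcoe (y : Kˣ) : ((∏ σ : Gal(K/F), Units.map (σ : K →* K) y : Kˣ) : K) =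
      ∏ σ : Gal(K/F), σ (y : K) := by
    rw [Units.coe_prod]
    rfl
  constructor
  · intro hx
    have hval := valuationOfNeZero_eq_one_of_mem_ladicKernel hx
    obtain ⟨u, rfl⟩ := exists_unit_of_valuationOfNeZero_eq_one hval
    refine ⟨u, rfl, ?_⟩
    set x := Units.map (algebraMap (𝓞 K) K : 𝓞 K →* K) u
    -- One place above ℓ is enough, because the local norm there is the global element N(x).
    obtain ⟨w, hw⟩ := exists_place_above ℓ K
    simp only [ladicKernel, Subgroup.mem_inf, Subgroup.mem_iInf, MonoidHom.mem_ker] at hx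
    have h := hx.1 w
    rw [finiteAbs, dif_pos hw] at h
    have h' : bracket ℓ (localNorm w hw x * normPow ℚ_[ℓ] w x) = 1 := congrArg Prod.fst h
    rw [normPow_eq_one_of_valuationOfNeZero_eq_one _ (hval w), mul_one] at h'
    obtain ⟨m, hm, j, hj⟩ := exists_pow_eq_zpow_of_bracket_eq_one h'
    have hj' := congrArg (padicToCompletion w hw) hj
    rw [map_pow, padicToCompletion_localNorm hF hK, map_zpow₀, map_natCast,
      ← map_natCast (algebraMap K (w.adicCompletion K)), ← map_zpow₀, ← map_pow] at hj'
    have hP := (algebraMap K (w.adicCompletion K)).injective hj'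
    have hPv : w.valuation K (∏ σ : Gal(K/F), σ (x : K)) = 1 := by
      rw [map_prod]
      refine Finset.prod_eq_one fun σ _ => ?_
      refine (transport_valuation σ.toRingEquiv (hK.asIdeal_eq_comap w hw σ) (x : K)).trans ?_
      rw [← HeightOneSpectrum.valuationOfNeZero_eq, hval, WithZero.coe_one]
    have hlv : w.valuation K (ℓ : K) < 1 := by
      rw [← map_natCast (algebraMap (𝓞 K) K), HeightOneSpectrum.valuation_lt_one_iff_mem]
      exact hw
    -- N(x)^m = ℓ^j now holds in K; at w the left side has trivial valuation and ℓ does not.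
    have hj0 : j = 0 := by
      have := congrArg (w.valuation K) hP
      rw [map_pow, hPv, one_pow, map_zpow₀] at this
      exact (zpow_eq_one_iff_right₀ zero_le hlv.ne).1 this.symm
    rw [hj0, zpow_zero] at hP
    refine isOfFinOrder_iff_pow_eq_one.2 ⟨m, hm, Units.ext ?_⟩
    rw [Units.val_pow_eq_pow_val, hcoe, hP, Units.val_one]
  · rintro ⟨u, rfl, hP⟩
    simp only [ladicKernel, Subgroup.mem_inf, Subgroup.mem_iInf, MonoidHom.mem_ker]
    refine ⟨fun w => ?_, fun τ => infiniteAbs_unit φ τ u⟩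
    have hval : w.valuationOfNeZero (Units.map (algebraMap (𝓞 K) K : 𝓞 K →* K) u) = 1 :=
      w.valuation_of_unit_eq u
    set x := Units.map (algebraMap (𝓞 K) K : 𝓞 K →* K) u
    by_cases hw : (ℓ : 𝓞 K) ∈ w.asIdeal
    · rw [finiteAbs, dif_pos hw]
      refine Prod.ext ?_ ?_
      · change bracket ℓ (localNorm w hw x * normPow ℚ_[ℓ] w x) = 1
        rw [normPow_eq_one_of_valuationOfNeZero_eq_one _ hval, mul_one]
        obtain ⟨m, hm, h⟩ := isOfFinOrder_iff_pow_eq_one.1 hP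
        refine bracket_eq_one_of_isOfFinOrder (isOfFinOrder_iff_pow_eq_one.2 ⟨m, hm, ?_⟩)
        refine Units.ext ((padicToCompletion w hw).injective ?_)
        rw [Units.val_pow_eq_pow_val, map_pow, padicToCompletion_localNorm hF hK, ← hcoe,
          ← map_pow, ← Units.val_pow_eq_pow_val, h, Units.val_one, Units.val_one, map_one, map_one]
      · change (normPow ℝ w x)⁻¹ = 1
        rw [normPow_eq_one_of_valuationOfNeZero_eq_one _ hval, inv_one]
    · rw [finiteAbs, dif_neg hw]
      refine Prod.ext ?_ rfl
      change bracket ℓ (normPow ℚ_[ℓ] w x) = 1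
      rw [normPow_eq_one_of_valuationOfNeZero_eq_one _ hval, map_one]

end KernelCharacterization
-- Rational traces computed on a real lattice
section LatticeTrace

open TensorProduct

/-- A linear map whose kernel is torsion becomes injective over `ℚ`. -/
theorem baseChange_rat_injective {A B : Type*} [AddCommGroup A] [AddCommGroup B]
    (q : A →ₗ[ℤ] B) (hq : Function.Surjective q) (hker : ∀ a, q a = 0 → IsOfFinAddOrder a) :
    Function.Injective (q.baseChange ℚ) := by
  rw [injective_iff_map_eq_zero]
  intro x hx
  have hex := lTensor_exact ℚ (LinearMap.exact_subtype_ker_map q) hq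
  obtain ⟨y, rfl⟩ := (hex x).1 hx
  have hzero (y : ℚ ⊗[ℤ] LinearMap.ker q) : (LinearMap.ker q).subtype.lTensor ℚ y = 0 := by
    induction y using TensorProduct.induction_on with
    | zero => exact map_zero _
    | add y z hy hz => rw [map_add, hy, hz, add_zero]
    | tmul r a =>
      obtain ⟨n, hn, h⟩ := isOfFinAddOrder_iff_nsmul_eq_zero.1 (hker a a.2)
      have hr : r = n • (r / n) := by
        rw [nsmul_eq_mul, mul_div_cancel₀ _ (Nat.cast_ne_zero.2 hn.ne')]
      rw [LinearMap.lTensor_tmul, Submodule.subtype_apply, hr, TensorProduct.smul_tmul, h,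
        TensorProduct.tmul_zero]
  exact hzero y

/-- If `A` modulo torsion is a lattice in a real vector space `W`, the trace of an endomorphism of
`A` over `ℚ` is the trace of the corresponding endomorphism of `W`. -/
theorem finite_and_trace_baseChange_of_lattice {A W : Type*} [AddCommGroup A]
    [NormedAddCommGroup W] [NormedSpace ℝ W] [FiniteDimensional ℝ W] (q : A →ₗ[ℤ] W)
    (hker : ∀ a, q a = 0 → IsOfFinAddOrder a) [DiscreteTopology (LinearMap.range q)]
    (hspan : Submodule.span ℝ (LinearMap.range q : Set W) = ⊤) :
    Module.Finite ℚ (ℚ ⊗[ℤ] A) ∧ ∀ (g : A →ₗ[ℤ] A) (f : W →ₗ[ℝ] W), (∀ a, q (g a) = f (q a)) →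
      ((LinearMap.trace ℚ _ (g.baseChange ℚ) : ℚ) : ℝ) = LinearMap.trace ℝ W f := by
  have : IsZLattice ℝ (LinearMap.range q) := ⟨hspan⟩
  have : Module.Free ℤ (LinearMap.range q) := ZLattice.module_free ℝ _
  have : Module.Finite ℤ (LinearMap.range q) := ZLattice.module_finite ℝ _
  let e : ℚ ⊗[ℤ] A ≃ₗ[ℚ] ℚ ⊗[ℤ] (LinearMap.range q) :=
    LinearEquiv.ofBijective (q.rangeRestrict.baseChange ℚ)
      ⟨baseChange_rat_injective _ q.surjective_rangeRestrict fun a ha =>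
        hker a (congrArg Subtype.val ha),
        LinearMap.lTensor_surjective ℚ q.surjective_rangeRestrict⟩
  refine ⟨Module.Finite.equiv e.symm, fun g f hgf => ?_⟩
  have hmem : ∀ y ∈ LinearMap.range q, (f.restrictScalars ℤ) y ∈ LinearMap.range q := by
    rintro _ ⟨a, rfl⟩
    exact ⟨g a, hgf a⟩
  let f' : LinearMap.range q →ₗ[ℤ] LinearMap.range q := (f.restrictScalars ℤ).restrict hmem
  have hconj : e.conj (g.baseChange ℚ) = f'.baseChange ℚ := by
    have hcomm : q.rangeRestrict ∘ₗ g = f' ∘ₗ q.rangeRestrict :=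
      LinearMap.ext fun a => Subtype.ext (hgf a)
    refine LinearMap.ext fun x => ?_
    obtain ⟨z, rfl⟩ := e.surjective x
    rw [LinearEquiv.conj_apply_apply, e.symm_apply_apply]
    change (q.rangeRestrict.baseChange ℚ ∘ₗ g.baseChange ℚ) z =
      (f'.baseChange ℚ ∘ₗ q.rangeRestrict.baseChange ℚ) z
    rw [← LinearMap.baseChange_comp, ← LinearMap.baseChange_comp, hcomm]
  rw [← LinearMap.trace_conj' (g.baseChange ℚ) e, hconj, LinearMap.trace_baseChange]
  -- A ℤ-basis of the lattice is also an ℝ-basis of W, so both traces come from the same integer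
  -- matrix.
  let b := Module.Free.chooseBasis ℤ (LinearMap.range q)
  rw [LinearMap.trace_eq_matrix_trace ℝ (b.ofZLatticeBasis ℝ (LinearMap.range q)),
    LinearMap.trace_eq_matrix_trace ℤ b, Matrix.trace, Matrix.trace]
  simp only [Matrix.diag_apply, LinearMap.toMatrix_apply, Module.Basis.ofZLatticeBasis_apply]
  rw [eq_intCast, Rat.cast_intCast, Int.cast_sum]
  exact Finset.sum_congr rfl fun i _ => (b.ofZLatticeBasis_repr_apply ℝ _ (f' (b i)) i).symm

end LatticeTrace

/-! ### The permutation representation on infinite places -/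

section PlacePermutation

open NumberField

variable (F K : Type*) [Field F] [Field K] [Algebra F K]

/-- The permutation representation of `Gal(K/F)` on the real functions on the infinite places
of `K`. -/
noncomputable def placeMap (σ : Gal(K/F)) : (InfinitePlace K → ℝ) →ₗ[ℝ] (InfinitePlace K → ℝ) :=
  LinearMap.funLeft ℝ ℝ fun w => σ⁻¹ • w

variable {F K}

theorem placeMap_apply (σ : Gal(K/F)) (y : InfinitePlace K → ℝ) (w : InfinitePlace K) :
    placeMap F K σ y w = y (σ⁻¹ • w) := rfl

theorem placeMap_placeMap (σ τ : Gal(K/F)) (y : InfinitePlace K → ℝ) :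
    placeMap F K σ (placeMap F K τ y) = placeMap F K (σ * τ) y := by
  ext w
  simp only [placeMap_apply, mul_inv_rev, mul_smul]

variable (F K) in
/-- The sum over the Galois group. -/
noncomputable def placeTrace [Fintype Gal(K/F)] :
    (InfinitePlace K → ℝ) →ₗ[ℝ] (InfinitePlace K → ℝ) :=
  ∑ σ : Gal(K/F), placeMap F K σ

section

variable [Fintype Gal(K/F)]

theorem placeTrace_apply (y : InfinitePlace K → ℝ) :
    placeTrace F K y = ∑ σ : Gal(K/F), placeMap F K σ y := by
  simp [placeTrace]

theorem placeTrace_placeMap (σ : Gal(K/F)) (y : InfinitePlace K → ℝ) :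
    placeTrace F K (placeMap F K σ y) = placeTrace F K y := by
  simp only [placeTrace_apply, placeMap_placeMap]
  exact Equiv.sum_comp (Equiv.mulRight σ) fun τ => placeMap F K τ y

/-- Hence T/n is idempotent, and 1 - T/n projects onto ker T. -/
theorem placeTrace_placeTrace (y : InfinitePlace K → ℝ) :
    placeTrace F K (placeTrace F K y) = (Fintype.card Gal(K/F) : ℝ) • placeTrace F K y := by
  conv_lhs => rw [placeTrace_apply y, map_sum]
  simp only [placeTrace_placeMap, Finset.sum_const, Finset.card_univ, Nat.cast_smul_eq_nsmul]

theorem placeMap_mem_ker {y : InfinitePlace K → ℝ} (hy : y ∈ LinearMap.ker (placeTrace F K))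
    (σ : Gal(K/F)) : placeMap F K σ y ∈ LinearMap.ker (placeTrace F K) := by
  rw [LinearMap.mem_ker, placeTrace_placeMap]
  exact hy

end

variable [NumberField K]

theorem trace_placeMap (σ : Gal(K/F)) :
    LinearMap.trace ℝ _ (placeMap F K σ) = (Nat.card {w : InfinitePlace K // σ • w = w} : ℝ) := by
  classical
  refine trace_eq_card_of_permutes_basis (Pi.basisFun ℝ (InfinitePlace K)) _ (fun w => σ • w)
    fun w => ?_
  ext u
  simp [placeMap_apply, Pi.single_apply, inv_smul_eq_iff]

variable [NumberField F] [IsGalois F K] [Fintype Gal(K/F)]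

/-- This is Burnside's orbit count, the orbits on the infinite places of K being the infinite places
of F. -/
theorem trace_placeTrace : LinearMap.trace ℝ _ (placeTrace F K) =
    (Fintype.card Gal(K/F) : ℝ) * Fintype.card (InfinitePlace F) := by
  classical
  have : Fintype (Quotient (MulAction.orbitRel Gal(K/F) (InfinitePlace K))) := Fintype.ofFinite _
  have h := MulAction.sum_card_fixedBy_eq_card_orbits_mul_card_group Gal(K/F) (InfinitePlace K)
  rw [Fintype.card_congr InfinitePlace.orbitRelEquiv] at h
  rw [placeTrace, map_sum]
  simp only [trace_placeMap]
  rw [mul_comm]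
  simp only [← Nat.card_eq_fintype_card] at h ⊢
  exact_mod_cast h

/-- The map σ - T/n takes all its values in ker T and agrees there with σ, so the trace on ker T is
its trace on the whole space. -/
theorem trace_placeMap_restrict (σ : Gal(K/F)) :
    LinearMap.trace ℝ _ ((placeMap F K σ).restrict (p := LinearMap.ker (placeTrace F K))
      fun _ hy => placeMap_mem_ker hy σ) =
    (Nat.card {w : InfinitePlace K // σ • w = w} : ℝ) - Fintype.card (InfinitePlace F) := by
  have hn : (Fintype.card Gal(K/F) : ℝ) ≠ 0 := Nat.cast_ne_zero.2 Fintype.card_ne_zero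
  let f := placeMap F K σ - (Fintype.card Gal(K/F) : ℝ)⁻¹ • placeTrace F K
  have hf : ∀ y, f y ∈ LinearMap.ker (placeTrace F K) := fun y => by
    simp only [f, LinearMap.mem_ker, LinearMap.sub_apply, LinearMap.smul_apply, map_sub, map_smul,
      placeTrace_placeMap, placeTrace_placeTrace, smul_smul, inv_mul_cancel₀ hn, one_smul, sub_self]
  have heq : (placeMap F K σ).restrict (p := LinearMap.ker (placeTrace F K))
      (fun _ hy => placeMap_mem_ker hy σ) = f.restrict fun y _ => hf y := by
    ext1 y
    refine Subtype.ext ?_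
    simp [f, LinearMap.restrict_apply, LinearMap.mem_ker.1 y.2]
  rw [heq, LinearMap.trace_restrict_eq_of_forall_mem _ _ hf, map_sub, map_smul, trace_placeMap,
    trace_placeTrace, smul_eq_mul, inv_mul_cancel_left₀ hn]

end PlacePermutation
-- Logarithms of units and the Galois action
section LogarithmicEmbedding

open NumberField NumberField.InfinitePlace NumberField.Units NumberField.Units.dirichletUnitTheorem

variable (K : Type*) [Field K]

/-- The logarithmic map on `Kˣ`, with one coordinate for each infinite place. -/
noncomputable def placeLog : Additive Kˣ →+ (InfinitePlace K → ℝ) where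
  toFun x w := mult w * Real.log (w (x.toMul : K))
  map_zero' := by
    ext
    simp
  map_add' x y := by
    ext w
    simp [Real.log_mul, mul_add]

variable {K}

theorem placeLog_apply (x : Kˣ) (w : InfinitePlace K) :
    placeLog K (Additive.ofMul x) w = mult w * Real.log (w (x : K)) := rfl

variable (K) in
/-- The embedding of the units of `𝓞 K` in `Kˣ`. -/
noncomputable abbrev unitsCoe : (𝓞 K)ˣ →* Kˣ := Units.map (algebraMap (𝓞 K) K : 𝓞 K →* K)

variable (K) in
/-- Forgetting the coordinate at the distinguished infinite place. -/
noncomputable def toLogSpace [NumberField K] : (InfinitePlace K → ℝ) →ₗ[ℝ] logSpace K :=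
  LinearMap.funLeft ℝ ℝ Subtype.val

theorem toLogSpace_placeLog [NumberField K] (u : (𝓞 K)ˣ) :
    toLogSpace K (placeLog K (Additive.ofMul (unitsCoe K u))) =
      logEmbedding K (Additive.ofMul u) := rfl

theorem sum_placeLog [NumberField K] (u : (𝓞 K)ˣ) :
    ∑ w, placeLog K (Additive.ofMul (unitsCoe K u)) w = 0 :=
  sum_mult_mul_log u

/-- `logSpace` drops the coordinate at `w₀`, which Galois need not preserve, so all coordinates are
kept here. On the sum-zero hyperplane the dropped coordinate is determined by the others, which
gives access to `unitLattice`. -/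
theorem eq_of_toLogSpace_eq [NumberField K] {y z : InfinitePlace K → ℝ} (hy : ∑ w, y w = 0)
    (hz : ∑ w, z w = 0) (h : toLogSpace K y = toLogSpace K z) : y = z := by
  classical
  have hne (w : InfinitePlace K) (hw : w ≠ w₀) : y w = z w := congrFun h ⟨w, hw⟩
  ext w
  by_cases hw : w = w₀
  · rw [Fintype.sum_eq_add_sum_compl w₀] at hy hz
    have : ∑ w ∈ ({w₀} : Finset (InfinitePlace K))ᶜ, y w = ∑ w ∈ ({w₀} : Finset _)ᶜ, z w :=
      Finset.sum_congr rfl fun w hw => hne w (by simpa using hw)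
    rw [hw]
    linarith
  · exact hne w hw

theorem isOfFinOrder_of_placeLog_eq_zero [NumberField K] (u : (𝓞 K)ˣ)
    (h : placeLog K (Additive.ofMul (unitsCoe K u)) = 0) : IsOfFinOrder u := by
  refine (CommGroup.mem_torsion u).1 (logEmbedding_eq_zero_iff.1 ?_)
  rw [← toLogSpace_placeLog, h, map_zero]

theorem placeLog_eq_zero_of_isOfFinOrder {x : Kˣ} (hx : IsOfFinOrder x) :
    placeLog K (Additive.ofMul x) = 0 := by
  obtain ⟨m, hm, h⟩ := isOfFinOrder_iff_pow_eq_one.1 hx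
  have := map_nsmul (placeLog K) m (Additive.ofMul x)
  rw [← ofMul_pow, h, ofMul_one, map_zero, eq_comm, smul_eq_zero] at this
  exact this.resolve_left hm.ne'

/-- Dirichlet's theorem: the logarithms of the units span the hyperplane of trace zero. -/
theorem mem_span_placeLog [NumberField K] {y : InfinitePlace K → ℝ} (hy : ∑ w, y w = 0) :
    y ∈ Submodule.span ℝ
      (Set.range fun u : (𝓞 K)ˣ => placeLog K (Additive.ofMul (unitsCoe K u))) := by
  set S := Submodule.span ℝ
    (Set.range fun u : (𝓞 K)ˣ => placeLog K (Additive.ofMul (unitsCoe K u)))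
  have hsum : ∀ z ∈ S, ∑ w, z w = 0 := by
    intro z hz
    induction hz using Submodule.span_induction with
    | mem z hz =>
      obtain ⟨u, rfl⟩ := hz
      exact sum_placeLog u
    | zero => simp
    | add a b _ _ ha hb => simp [Finset.sum_add_distrib, ha, hb]
    | smul c a _ ha => simp [← Finset.mul_sum, ha]
  have hmap : S.map (toLogSpace K) = ⊤ := by
    rw [Submodule.map_span, ← Set.range_comp, eq_top_iff, ← unitLattice_span_eq_top K]
    refine Submodule.span_mono ?_
    rintro _ ⟨u, -, rfl⟩
    exact ⟨u.toMul, rfl⟩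
  obtain ⟨z, hz, hzy⟩ : toLogSpace K y ∈ S.map (toLogSpace K) := hmap ▸ Submodule.mem_top
  rwa [← eq_of_toLogSpace_eq (hsum z hz) hy hzy]

variable {F : Type*} [Field F] [Algebra F K]

/-- The value of σx at w is the value of x at σ⁻¹w, which accounts for the inverse in `placeMap`. -/
theorem placeLog_galois (σ : Gal(K/F)) (x : Kˣ) :
    placeLog K (Additive.ofMul (Units.map (σ : K →* K) x)) =
      placeMap F K σ (placeLog K (Additive.ofMul x)) := by
  ext w
  have hm : mult (σ⁻¹ • w) = mult w := by
    classical
    exact if_congr isReal_smul_iff rfl rfl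
  rw [placeMap_apply, placeLog_apply, placeLog_apply, hm]
  rfl

variable [Fintype Gal(K/F)]

theorem placeLog_prod_galois (x : Kˣ) :
    placeLog K (Additive.ofMul (∏ σ : Gal(K/F), Units.map (σ : K →* K) x)) =
      placeTrace F K (placeLog K (Additive.ofMul x)) := by
  rw [ofMul_prod, map_sum, placeTrace_apply]
  exact Finset.sum_congr rfl fun σ _ => placeLog_galois σ x

theorem map_prod_galois (τ : Gal(K/F)) (x : Kˣ) :
    Units.map (τ : K →* K) (∏ σ : Gal(K/F), Units.map (σ : K →* K) x) =
      ∏ σ : Gal(K/F), Units.map (σ : K →* K) x := by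
  rw [map_prod]
  exact Equiv.prod_comp (Equiv.mulLeft τ) fun σ : Gal(K/F) => Units.map (σ : K →* K) x

/-- The coordinates of Ty add up to n times those of y. -/
theorem sum_eq_zero_of_mem_ker_placeTrace [NumberField K] {y : InfinitePlace K → ℝ}
    (hy : y ∈ LinearMap.ker (placeTrace F K)) : ∑ w, y w = 0 := by
  have h : ∑ w, placeTrace F K y w = (Fintype.card Gal(K/F) : ℝ) * ∑ w, y w := by
    simp only [placeTrace_apply, Finset.sum_apply]
    rw [Finset.sum_comm]
    have (σ : Gal(K/F)) : ∑ w, placeMap F K σ y w = ∑ w, y w :=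
      Equiv.sum_comp (MulAction.toPerm σ⁻¹) y
    simp [this]
  rw [LinearMap.mem_ker.1 hy] at h
  simpa [Fintype.card_ne_zero] using h.symm

end LogarithmicEmbedding

/-! ### The kernel as a lattice in ker T -/

section KernelLattice

open NumberField NumberField.Units NumberField.Units.dirichletUnitTheorem

variable {ℓ : ℕ} [Fact ℓ.Prime] {F K : Type*} [Field F] [NumberField F] [Field K] [NumberField K]
  [Algebra F K] [IsGalois F K] [Fintype Gal(K/F)]

/-- The logarithmic map on `μ_K^{(ℓ)}`. -/
noncomputable def kernelLog (hF : IsTotallyLadic ℓ F) (hK : IsNonSplitAbove ℓ F K)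
    (φ : ℂ →+* ℂ_[ℓ]) : Additive (ladicKernel K φ) →ₗ[ℤ] LinearMap.ker (placeTrace F K) :=
  LinearMap.codRestrict ((LinearMap.ker (placeTrace F K)).restrictScalars ℤ)
    ((placeLog K).comp (ladicKernel K φ).subtype.toAdditive).toIntLinearMap fun x => by
      obtain ⟨-, -, h⟩ := (mem_ladicKernel_iff hF hK φ _).1 x.toMul.2
      exact (placeLog_prod_galois (F := F) (x.toMul : Kˣ)).symm.trans
        (placeLog_eq_zero_of_isOfFinOrder h)

theorem kernelLog_coe (hF : IsTotallyLadic ℓ F) (hK : IsNonSplitAbove ℓ F K) (φ : ℂ →+* ℂ_[ℓ])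
    (x : Additive (ladicKernel K φ)) :
    (kernelLog hF hK φ x : InfinitePlace K → ℝ) =
      placeLog K (Additive.ofMul (x.toMul : Kˣ)) := rfl

theorem isOfFinAddOrder_of_kernelLog_eq_zero (hF : IsTotallyLadic ℓ F)
    (hK : IsNonSplitAbove ℓ F K) (φ : ℂ →+* ℂ_[ℓ]) (x : Additive (ladicKernel K φ))
    (hx : kernelLog hF hK φ x = 0) : IsOfFinAddOrder x := by
  obtain ⟨u, hu, -⟩ := (mem_ladicKernel_iff hF hK φ _).1 x.toMul.2
  have h := congrArg Subtype.val hx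
  rw [kernelLog_coe, ← hu] at h
  have h' := (unitsCoe K).isOfFinOrder (isOfFinOrder_of_placeLog_eq_zero u h)
  rw [unitsCoe, hu, Submonoid.isOfFinOrder_coe] at h'
  exact (isOfFinAddOrder_ofMul_iff (x := x.toMul)).2 h'

/-- Dropping a coordinate maps the range continuously and injectively into the discrete
`unitLattice`. -/
theorem discreteTopology_range_kernelLog (hF : IsTotallyLadic ℓ F) (hK : IsNonSplitAbove ℓ F K)
    (φ : ℂ →+* ℂ_[ℓ]) : DiscreteTopology (LinearMap.range (kernelLog hF hK φ)) := by
  have hmem (y : LinearMap.range (kernelLog hF hK φ)) :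
      toLogSpace K (y : LinearMap.ker (placeTrace F K)) ∈ unitLattice K := by
    obtain ⟨_, x, rfl⟩ := y
    obtain ⟨u, hu, -⟩ := (mem_ladicKernel_iff hF hK φ _).1 x.toMul.2
    rw [kernelLog_coe, ← hu, toLogSpace_placeLog]
    exact ⟨_, trivial, rfl⟩
  refine DiscreteTopology.of_continuous_injective (β := unitLattice K)
    (f := fun y => ⟨_, hmem y⟩) (Continuous.subtype_mk ?_ _) fun y z h => ?_
  · exact (LinearMap.continuous_of_finiteDimensional (toLogSpace K)).comp
      (continuous_subtype_val.comp continuous_subtype_val)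
  · exact Subtype.ext (Subtype.ext (eq_of_toLogSpace_eq (sum_eq_zero_of_mem_ker_placeTrace y.1.2)
      (sum_eq_zero_of_mem_ker_placeTrace z.1.2) (congrArg Subtype.val h)))

/-- The norm of uⁿ/N(u) is N(u)ⁿ/N(u)ⁿ = 1. This is the multiplicative form of n - T and supplies
enough elements of the kernel to span. -/
theorem pow_card_div_prod_galois_mem_ladicKernel (hF : IsTotallyLadic ℓ F)
    (hK : IsNonSplitAbove ℓ F K) (φ : ℂ →+* ℂ_[ℓ]) (u : (𝓞 K)ˣ) :
    unitsCoe K u ^ Fintype.card Gal(K/F) / ∏ σ : Gal(K/F), Units.map (σ : K →* K) (unitsCoe K u) ∈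
      ladicKernel K φ := by
  refine (mem_ladicKernel_iff hF hK φ _).2 ⟨u ^ Fintype.card Gal(K/F) /
    ∏ σ : Gal(K/F), Units.map (RingOfIntegers.mapRingEquiv σ.toRingEquiv : 𝓞 K →* 𝓞 K) u, ?_, ?_⟩
  · rw [map_div, map_pow, map_prod]
    rfl
  · simp only [map_div, map_pow, map_prod_galois, Finset.prod_div_distrib, Finset.prod_pow,
      Finset.prod_const, Finset.card_univ, div_self']
    exact IsOfFinOrder.one

/-- The map n - T sends the logarithm of u to that of uⁿ/N(u), hence, by Dirichlet, the whole
sum-zero hyperplane into the span. On ker T it is multiplication by n, which is invertible over ℝ.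
-/
theorem span_range_kernelLog (hF : IsTotallyLadic ℓ F) (hK : IsNonSplitAbove ℓ F K)
    (φ : ℂ →+* ℂ_[ℓ]) :
    Submodule.span ℝ (LinearMap.range (kernelLog hF hK φ) : Set (LinearMap.ker (placeTrace F K))) =
      ⊤ := by
  set S := Submodule.span ℝ
    (LinearMap.range (kernelLog hF hK φ) : Set (LinearMap.ker (placeTrace F K)))
  have hn : (Fintype.card Gal(K/F) : ℝ) ≠ 0 := Nat.cast_ne_zero.2 Fintype.card_ne_zero
  let f : (InfinitePlace K → ℝ) →ₗ[ℝ] (InfinitePlace K → ℝ) :=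
    (Fintype.card Gal(K/F) : ℝ) • LinearMap.id - placeTrace F K
  have hle : Submodule.span ℝ
      (Set.range fun u : (𝓞 K)ˣ => placeLog K (Additive.ofMul (unitsCoe K u))) ≤
      (S.map (LinearMap.ker (placeTrace F K)).subtype).comap f := by
    rw [Submodule.span_le]
    rintro _ ⟨u, rfl⟩
    refine ⟨kernelLog hF hK φ (Additive.ofMul
      ⟨_, pow_card_div_prod_galois_mem_ladicKernel hF hK φ u⟩),
      Submodule.subset_span ⟨_, rfl⟩, ?_⟩
    rw [Submodule.subtype_apply, kernelLog_coe]
    simp only [toMul_ofMul, ofMul_div, ofMul_pow, map_sub, map_nsmul, placeLog_prod_galois, f,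
      LinearMap.sub_apply, LinearMap.smul_apply, LinearMap.id_apply, Nat.cast_smul_eq_nsmul]
  refine eq_top_iff.2 fun y _ => ?_
  obtain ⟨z, hz, hzy⟩ := hle (mem_span_placeLog (sum_eq_zero_of_mem_ker_placeTrace y.2))
  have hzy' : z = (Fintype.card Gal(K/F) : ℝ) • y := by
    refine Subtype.ext (hzy.trans ?_)
    simp [f, LinearMap.mem_ker.1 y.2]
  rw [← inv_smul_smul₀ hn y, ← hzy']
  exact S.smul_mem _ hz

theorem kernelLog_galKernelMap (hF : IsTotallyLadic ℓ F) (hK : IsNonSplitAbove ℓ F K)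
    (φ : ℂ →+* ℂ_[ℓ]) (g : Gal(K/F)) (x : Additive (ladicKernel K φ)) :
    kernelLog hF hK φ ((galKernelMap F K φ g).toAdditive.toIntLinearMap x) =
      (placeMap F K g).restrict (p := LinearMap.ker (placeTrace F K))
        (fun _ hy => placeMap_mem_ker hy g) (kernelLog hF hK φ x) :=
  Subtype.ext (placeLog_galois g (x.toMul : Kˣ))

end KernelLattice

end LadicWeil

theorem mainTheorem5 (ℓ : ℕ) [Fact ℓ.Prime]
    (F K : Type*) [Field F] [NumberField F] [Field K] [NumberField K] [Algebra F K] [IsGalois F K]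
    (hF : LadicWeil.IsTotallyLadic ℓ F) (hK : LadicWeil.IsNonSplitAbove ℓ F K)
    (φ : ℂ →+* ℂ_[ℓ])
    (w : NumberField.InfinitePlace F → NumberField.InfinitePlace K)
    (hw : ∀ v, (w v).comap (algebraMap F K) = v) :
    Module.Finite ℚ (TensorProduct ℤ ℚ (Additive (LadicWeil.ladicKernel K φ))) ∧
      ∀ g : Gal(K/F), (LadicWeil.kernelRep F K φ).character g =
        ∑ v : NumberField.InfinitePlace F,
          (LadicWeil.inducedTrivialCharacter (LadicWeil.decompositionGroup F (w v)) g - 1) := by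
  have : FiniteDimensional F K := Module.Finite.of_restrictScalars_finite ℚ F K
  have : Fintype Gal(K/F) := Fintype.ofFinite _
  have := LadicWeil.discreteTopology_range_kernelLog hF hK φ
  obtain ⟨hfin, htrace⟩ := LadicWeil.finite_and_trace_baseChange_of_lattice
    (LadicWeil.kernelLog hF hK φ) (LadicWeil.isOfFinAddOrder_of_kernelLog_eq_zero hF hK φ)
    (LadicWeil.span_range_kernelLog hF hK φ)
  refine ⟨hfin, fun g => ?_⟩
  have h := (htrace _ _ (LadicWeil.kernelLog_galKernelMap hF hK φ g)).trans
    (LadicWeil.trace_placeMap_restrict g)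
  rw [Finset.sum_sub_distrib, LadicWeil.sum_inducedTrivialCharacter F K w hw, Finset.sum_const,
    Finset.card_univ, nsmul_eq_mul, mul_one]
  -- The traces were compared in ℝ; both sides are rational.
  exact_mod_cast h
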